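/- Let $d(x,y)=\arccos\langle x,y\rangle$ be the geodesic distance and $dy$ the surface measure (total mass $4\pi$) on the unit sphere $S^2\subset\mathbb R^3$, let $P_\ell$ be the Legendre polynomials ($P_\ell(1)=1$) and $H_q$ the probabilists' Hermite polynomials. Let $T=\{T(x):x\in S^2\}$ be a jointly measurable, zero-mean, isotropic Gaussian random field on a probability space, let $B>1$, and let $b:\mathbb R\to\mathbb R$ vanish outside $[B^{-1},B]$. For $j\in\mathbb N$ put $$\beta_j(x)=\int_{S^2}\sum_{\ell}b\Big(\frac{\ell}{B^j}\Big)\frac{2\ell+1}{4\pi}P_\ell(\langle x,y\rangle)\,T(y)\,dy,\qquad \widetilde\beta_j(x)=\frac{\beta_j(x)}{\sqrt{\operatorname{Var}\beta_j(x)}}$$ (with $\widetilde\beta_j=0$ if the variance is zero). Let $L_K\in\mathbb N$, let $\kappa(0),\dots,\kappa(L_K)\in\mathbb R$, let $K$ be the kernel with the finite Legendre expansion $K(t)=\sum_{\ell=0}^{L_K}\frac{2\ell+1}{4\pi}\kappa(\ell)P_\ell(t)$, and for $q\in\mathbb N$ let $$g_{j;q}(x)=\int_{S^2}K(\langle x,y\rangle)\,H_q(\widetilde\beta_j(y))\,dy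 .$$ For each $j$ let $f_{j;q}$ be an isotropic zero-mean Gaussian field on $S^2$ with almost surely continuous paths (possibly on another probability space) and with the same covariance function as $g_{j;q}$. Then, for every $q\in\mathbb N$, the fields $g_{j;q}$ and $f_{j;q}$ are random elements of $C(S^2)$ (almost surely continuous, with measurable path map), and both sequences $\{g_{j;q}\}_j$ and $\{f_{j;q}\}_j$ are tight in $C(S^2)$. Moreover, for every $q\in\mathbb N$ and $M\in\mathbb R$ there is a constant $C>0$, depending only on $q$ and $M$, such that whenever $\max_{\ell\le L_K}|\kappa(\ell)|\le M$, for all $j$ and all $\delta>0$, $$\mathbb E\Big\{\sup_{d(x_1,x_2)\le\delta}|f_{j;q}(x_1)-f_{j;q}(x_2)|\Big\}\le C L_K^3\,\delta,\qquad \mathbb E\Big\{\sup_{d(x_1,x_2)\le\delta}|g_{j;q}(x_1)-g_{j;q}(x_2)|\Big\}\le C L_K^3\,\delta .$$ -/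

import Mathlib

open MeasureTheory ProbabilityTheory Set Filter Topology
open scoped ENNReal

noncomputable section

namespace SphericalField

/-- Euclidean three-space. -/
abbrev E3 : Type := EuclideanSpace ℝ (Fin 3)

/-- The unit sphere `S²`. -/
abbrev S2 : Type := Metric.sphere (0 : E3) 1

/-- The surface measure of the sphere, of total mass `4π`. -/
def surface : Measure S2 := (volume : Measure E3).toSphere

/-- The inner product of two points of the sphere. -/
def dotS (x y : S2) : ℝ := inner ℝ (x : E3) (y : E3)

/-- The geodesic distance on the sphere. -/
def geoDist (x y : S2) : ℝ := Real.arccos (dotS x y)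

/-- The Legendre polynomial `P_ℓ`, with `P_ℓ(1) = 1`. Mathlib has it in the shifted form
`P_ℓ(1 - 2s)`. -/
def legendre (l : ℕ) (t : ℝ) : ℝ :=
  Polynomial.aeval ((1 - t) / 2) (Polynomial.shiftedLegendre l)

/-- The probabilists' Hermite polynomial `H_q`. -/
def hermiteH (q : ℕ) (t : ℝ) : ℝ := Polynomial.aeval t (Polynomial.hermite q)

/-- The action of a linear isometry on the sphere. -/
def rotate (R : E3 ≃ₗᵢ[ℝ] E3) (x : S2) : S2 :=
  ⟨R x, by simp⟩

/-- `X` is a zero-mean Gaussian field on the sphere which is isotropic: its finite-dimensional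
distributions are invariant under rotations. -/
structure IsIsotropicGaussian {Ω : Type*} [MeasurableSpace Ω] (X : S2 → Ω → ℝ)
    (P : Measure Ω) : Prop where
  gaussian : IsGaussianProcess X P
  zero_mean : ∀ x, ∫ ω, X x ω ∂P = 0
  isotropic : ∀ R : E3 ≃ₗᵢ[ℝ] E3, LinearMap.det (R.toLinearEquiv : E3 →ₗ[ℝ] E3) = 1 →
    ∀ I : Finset S2,
      P.map (fun ω (i : I) ↦ X (rotate R i) ω) = P.map (fun ω (i : I) ↦ X i ω)

/-- The needlet kernel `Ψ_j(t) = ∑_ℓ b(ℓ / B^j) (2ℓ + 1)/(4π) P_ℓ(t)`. When `b` vanishes outside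
`[B⁻¹, B]` and `B > 1`, only finitely many terms are non-zero. -/
def needletKernel (B : ℝ) (b : ℝ → ℝ) (j : ℕ) (t : ℝ) : ℝ :=
  ∑' l : ℕ, b (l / B ^ j) * ((2 * l + 1) / (4 * Real.pi)) * legendre l t

/-- The needlet field `β_j(x) = ∫ Ψ_j(⟨x, y⟩) T(y) dy`. -/
def needletField {Ω : Type*} (B : ℝ) (b : ℝ → ℝ) (T : S2 → Ω → ℝ) (j : ℕ) (x : S2) (ω : Ω) : ℝ :=
  ∫ y, needletKernel B b j (dotS x y) * T y ω ∂surface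

/-- The needlet field normalised to unit variance (it is `0` where the variance vanishes). -/
def normalizedNeedletField {Ω : Type*} [MeasurableSpace Ω] (P : Measure Ω) (B : ℝ) (b : ℝ → ℝ)
    (T : S2 → Ω → ℝ) (j : ℕ) (x : S2) (ω : Ω) : ℝ :=
  needletField B b T j x ω / √(variance (needletField B b T j x) P)

/-- The smoothing kernel `K(t) = ∑_{ℓ ≤ L} (2ℓ + 1)/(4π) κ(ℓ) P_ℓ(t)`. -/
def smoothingKernel (L : ℕ) (κ : ℕ → ℝ) (t : ℝ) : ℝ :=
  ∑ l ∈ Finset.range (L + 1), (2 * l + 1) / (4 * Real.pi) * κ l * legendre l t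

/-- The field `g_{j;q}(x) = ∫ K(⟨x, y⟩) H_q(β̃_j(y)) dy`. -/
def gField {Ω : Type*} [MeasurableSpace Ω] (P : Measure Ω) (L : ℕ) (κ : ℕ → ℝ)
    (B : ℝ) (b : ℝ → ℝ) (T : S2 → Ω → ℝ) (q j : ℕ) (x : S2) (ω : Ω) : ℝ :=
  ∫ y, smoothingKernel L κ (dotS x y) * hermiteH q (normalizedNeedletField P B b T j y ω) ∂surface

/-- `C(S²)`, with the topology of uniform convergence, carries its Borel σ-algebra. -/
instance : MeasurableSpace C(S2, ℝ) := borel _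

instance : BorelSpace C(S2, ℝ) := ⟨rfl⟩

open Classical in
/-- A continuous function as an element of `C(S²)`; the value at discontinuous functions is
irrelevant, because it is only used for fields with almost surely continuous paths. -/
def toPath (F : S2 → ℝ) : C(S2, ℝ) := if h : Continuous F then ⟨F, h⟩ else 0

/-- The field `X` is a random element of `C(S²)`. -/
structure IsRandomContinuous {Ω : Type*} [MeasurableSpace Ω] (X : S2 → Ω → ℝ)
    (P : Measure Ω) : Prop where
  continuous_paths : ∀ᵐ ω ∂P, Continuous fun x ↦ X x ω
  aemeasurable_path : AEMeasurable (fun ω ↦ toPath fun x ↦ X x ω) P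

/-- The law on `C(S²)` of a random element of `C(S²)`. -/
def pathLaw {Ω : Type*} [MeasurableSpace Ω] (X : S2 → Ω → ℝ) (P : Measure Ω) :
    Measure C(S2, ℝ) :=
  P.map fun ω ↦ toPath fun x ↦ X x ω

/-- The modulus of continuity `sup_{d(x₁, x₂) ≤ δ} |F(x₁) - F(x₂)|`, as an extended real. -/
def modulus (δ : ℝ) (F : S2 → ℝ) : ℝ≥0∞ :=
  ⨆ (x : S2) (y : S2) (_ : geoDist x y ≤ δ), ENNReal.ofReal |F x - F y|

end SphericalField

end

/-! Both fields are smoothings `∫ k(⟨x, y⟩) h(y) dy` of a random function `h` by a polynomial kernel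
whose coefficients are bounded by some `m`. Such a kernel is Lipschitz in `x` with constant `m L³`
(`abs_smoothingKernel_sub_le`, from a Bernstein inequality for Legendre polynomials). So the modulus
of continuity at `δ` is at most `m L³ δ ∫ |h|`, and everything reduces to bounding `E ∫ |h|`
uniformly in `j`.

For `g` one takes `h = H_q(β̃_j)`. Since `β_j(x)` is a centred Gaussian variable
(`exists_map_smoothing_eq_gaussianReal`), `β̃_j(x)` is standard normal or zero, and the second
moment of `h` is bounded in terms of `q` alone (`hermiteH_normalized`).

For `f` no representation is given, only its covariance. The kernels compose by multiplying
coefficients, so the kernel with all coefficients `1` is a projection that reproduces the covariance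
of `g`, hence that of `f`. Then `f` minus its projection has zero variance, and `f` is almost surely
its own smoothing (`exists_smoothing_of_covariance_eq`). Here `h = f`, and `E ∫ f² ≤ E ∫ g² ≤ M² E ∫
H_q(β̃_j)²` because smoothing is bounded on `L²`.

Tightness follows from the same control: a bound on `∫ |h|` confines the path to a set of bounded
Lipschitz functions, compact by Arzelà–Ascoli, and Markov's inequality bounds the remaining mass. -/

noncomputable section

namespace SphericalField

open Polynomial
open scoped Pointwise

/-! ### Legendre polynomials: differential equation and Bernstein inequality -/

/-- The shifted Legendre polynomial with real coefficients. -/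
def shiftedLegendreReal (l : ℕ) : ℝ[X] := (shiftedLegendre l).map (Int.castRingHom ℝ)

/-- The Legendre polynomial as an element of `ℝ[X]`. -/
def legendrePoly (l : ℕ) : ℝ[X] := (shiftedLegendreReal l).comp (C (1 / 2) * (1 - X))

lemma eval_shiftedLegendreReal (l : ℕ) (s : ℝ) :
    (shiftedLegendreReal l).eval s = aeval s (shiftedLegendre l) := by
  simp [shiftedLegendreReal, aeval_def, eval_map]

lemma eval_legendrePoly (l : ℕ) (t : ℝ) : (legendrePoly l).eval t = legendre l t := by
  rw [legendrePoly, eval_comp, eval_shiftedLegendreReal, legendre]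
  congr 2
  simp
  ring

lemma natDegree_legendrePoly (l : ℕ) : (legendrePoly l).natDegree = l := by
  have h1 : (C (1 / 2 : ℝ) * (1 - X) : ℝ[X]).natDegree = 1 := by
    have : (C (1 / 2 : ℝ) * (1 - X) : ℝ[X]) = C (-1 / 2) * X + C (1 / 2) := by
      rw [show (-1 / 2 : ℝ) = -(1 / 2) by norm_num, C_neg]
      ring
    rw [this]
    exact natDegree_linear (by norm_num)
  rw [legendrePoly, natDegree_comp, h1, mul_one, shiftedLegendreReal,
    natDegree_map_eq_of_injective (Int.cast_injective), natDegree_shiftedLegendre]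

lemma legendre_one (l : ℕ) : legendre l 1 = 1 := by
  rw [legendre]
  simp [aeval_def, eval₂_at_zero, coeff_shiftedLegendre]

lemma legendre_neg (l : ℕ) (t : ℝ) : legendre l (-t) = (-1) ^ l * legendre l t := by
  rw [legendre, legendre, shiftedLegendre_eval_symm]
  congr 3
  ring

/-- The hypergeometric recurrence, read off from ratios of consecutive binomial coefficients; it is
the differential equation compared coefficient by coefficient. -/
lemma coeff_shiftedLegendreReal_succ (l k : ℕ) :
    ((k : ℝ) + 1) ^ 2 * (shiftedLegendreReal l).coeff (k + 1) =
      ((k : ℝ) * (k + 1) - l * (l + 1)) * (shiftedLegendreReal l).coeff k := by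
  simp only [shiftedLegendreReal, coeff_map, coeff_shiftedLegendre]
  have h1 : (l.choose (k + 1) : ℝ) * (k + 1) = l.choose k * (l - k) := by
    rcases le_or_gt k l with h | h
    · have := Nat.choose_succ_right_eq l k
      have h2 : ((l.choose (k + 1) * (k + 1) : ℕ) : ℝ) = ((l.choose k * (l - k) : ℕ) : ℝ) := by
        rw [this]
      push_cast [Nat.cast_sub h] at h2
      exact h2
    · simp [Nat.choose_eq_zero_of_lt h, Nat.choose_eq_zero_of_lt (h.trans (Nat.lt_succ_self k))]
  have h2 : ((l + (k + 1)).choose l : ℝ) * (k + 1) = (l + k).choose l * (l + k + 1) := by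
    have := Nat.add_one_mul_choose_eq (l + k) k
    have h3 : ((l + k + 1) * (l + k).choose k : ℕ) = (((l + k + 1).choose (k + 1) * (k + 1) : ℕ)) :=
      this
    rw [← Nat.choose_symm_of_eq_add (show l + k = l + k from rfl),
      ← Nat.choose_symm_of_eq_add (show l + k + 1 = l + (k + 1) by ring)] at h3
    have h4 := congrArg (Nat.cast (R := ℝ)) h3
    push_cast at h4
    rw [show l + (k + 1) = l + k + 1 by ring]
    linarith
  simp only [eq_intCast, Int.cast_mul, Int.cast_pow, Int.cast_neg, Int.cast_one, Int.cast_natCast]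
  calc _ = -(-1) ^ k * ((l.choose (k + 1) : ℝ) * (k + 1)) *
        (((l + (k + 1)).choose l : ℝ) * (k + 1)) := by ring
    _ = _ := by rw [h1, h2]; ring

lemma shiftedLegendreReal_ode (l : ℕ) :
    X * (1 - X) * derivative (derivative (shiftedLegendreReal l)) +
      (1 - 2 * X) * derivative (shiftedLegendreReal l) +
      C ((l : ℝ) * (l + 1)) * shiftedLegendreReal l = 0 := by
  ext k
  have h := coeff_shiftedLegendreReal_succ l k
  have e : X * (1 - X) * derivative (derivative (shiftedLegendreReal l)) +
      (1 - 2 * X) * derivative (shiftedLegendreReal l) +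
      C ((l : ℝ) * (l + 1)) * shiftedLegendreReal l =
      X * derivative (derivative (shiftedLegendreReal l)) -
      X * (X * derivative (derivative (shiftedLegendreReal l))) +
      derivative (shiftedLegendreReal l) - C 2 * (X * derivative (shiftedLegendreReal l)) +
      C ((l : ℝ) * (l + 1)) * shiftedLegendreReal l := by
    rw [show (C 2 : ℝ[X]) = 2 from rfl]; ring
  rw [e]
  generalize (l : ℝ) * (l + 1) = c at h ⊢
  -- The term with two factors `X` shifts the index twice, so the indices 0 and 1 are separate.
  rcases k with _ | _ | k
  · simp [coeff_derivative] at h ⊢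
    linarith
  · simp [coeff_X_mul, coeff_derivative] at h ⊢
    linarith
  · simp [coeff_X_mul, coeff_derivative] at h ⊢
    linear_combination h

/-- Legendre's differential equation. -/
lemma legendrePoly_ode (l : ℕ) :
    (1 - X ^ 2) * derivative (derivative (legendrePoly l)) - 2 * X * derivative (legendrePoly l) =
      -(C ((l : ℝ) * (l + 1)) * legendrePoly l) := by
  have h := congrArg (fun p : ℝ[X] ↦ p.comp (C (1 / 2) * (1 - X))) (shiftedLegendreReal_ode l)
  simp only [add_comp, mul_comp, sub_comp, X_comp, one_comp, C_comp, zero_comp, ofNat_comp] at h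
  have hh : (2 : ℝ[X]) * C (1 / 2) = 1 := by
    rw [show (2 : ℝ[X]) = C 2 from rfl, ← C_mul]; norm_num
  simp only [legendrePoly, derivative_comp, derivative_mul, derivative_C, derivative_sub,
    derivative_one, derivative_X, zero_mul, zero_sub, zero_add, mul_neg, mul_one, neg_mul,
    derivative_neg, neg_neg]
  set c : ℝ[X] := C (1 / 2)
  set A := (derivative (derivative (shiftedLegendreReal l))).comp (c * (1 - X))
  set A' := (derivative (shiftedLegendreReal l)).comp (c * (1 - X))
  set A'' := (shiftedLegendreReal l).comp (c * (1 - X))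
  linear_combination h + A' * hh + c * (1 - X) * A * hh

/-- By the differential equation the energy `l(l+1) P² + (1 - t²) P'²` has derivative `2 t P'²`. It
therefore increases on `[0, 1]` up to its value `l(l+1)` at `1`. Negative `t` follow by parity. -/
lemma legendre_bernstein (l : ℕ) {t : ℝ} (ht : t ∈ Icc (-1 : ℝ) 1) :
    (1 - t ^ 2) * ((derivative (legendrePoly l)).eval t) ^ 2 ≤ l * (l + 1) := by
  have key : ∀ m : ℕ, ∀ s ∈ Icc (0 : ℝ) 1,
      (1 - s ^ 2) * ((derivative (legendrePoly m)).eval s) ^ 2 ≤ m * (m + 1) := by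
    intro m s hs
    set v : ℝ[X] := C ((m : ℝ) * (m + 1)) * legendrePoly m ^ 2 +
      (1 - X ^ 2) * derivative (legendrePoly m) ^ 2 with hv
    have hd : derivative v = 2 * X * derivative (legendrePoly m) ^ 2 := by
      have h := legendrePoly_ode m
      simp only [hv, derivative_add, derivative_mul, derivative_C, derivative_pow, derivative_sub,
        derivative_one, derivative_X]
      simp only [Nat.cast_ofNat, map_ofNat]
      linear_combination 2 * derivative (legendrePoly m) * h
    have hmono : MonotoneOn (fun x ↦ v.eval x) (Icc 0 1) := by
      apply monotoneOn_of_deriv_nonneg (convex_Icc 0 1) v.continuous.continuousOn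
        v.differentiable.differentiableOn
      intro x hx
      rw [interior_Icc] at hx
      rw [Polynomial.deriv, hd]
      simp only [eval_mul, eval_pow, eval_X, eval_ofNat]
      have := hx.1
      positivity
    have h1 := hmono hs ⟨zero_le_one, le_rfl⟩ hs.2
    simp only [hv, eval_add, eval_mul, eval_C, eval_pow, eval_sub, eval_one, eval_X,
      eval_legendrePoly, legendre_one] at h1
    have : 0 ≤ (m : ℝ) * (m + 1) * legendre m s ^ 2 := by positivity
    nlinarith
  rcases le_total 0 t with h0 | h0
  · exact key l t ⟨h0, ht.2⟩
  · have h := key l (-t) ⟨by linarith, by linarith [ht.1]⟩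
    have hsymm : (legendrePoly l).comp (-X) = C ((-1) ^ l) * legendrePoly l := by
      apply Polynomial.funext
      intro r
      simp [eval_legendrePoly, legendre_neg]
    have h2 := congrArg (fun p ↦ (eval t (derivative p)) ^ 2) hsymm
    simp only [derivative_comp, derivative_neg, derivative_X, derivative_mul, derivative_C, eval_mul,
      eval_comp, eval_neg, eval_X, eval_one, eval_C, zero_mul, zero_add,
      mul_pow, neg_sq, one_pow, one_mul, ← pow_mul, mul_comm l 2] at h2
    rw [pow_mul, neg_one_sq, one_pow, one_mul] at h2
    rwa [h2, neg_sq] at h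

/-- In the angle, the derivative is `-sin θ · P'(cos θ)`, whose square is at most `l(l+1) ≤ (2l)²`.
-/
lemma abs_legendre_cos_sub_le (l : ℕ) (a b : ℝ) :
    |legendre l (Real.cos a) - legendre l (Real.cos b)| ≤ 2 * l * |a - b| := by
  have hd : ∀ x ∈ (univ : Set ℝ), HasDerivWithinAt (fun x ↦ (legendrePoly l).eval (Real.cos x))
      ((derivative (legendrePoly l)).eval (Real.cos x) * -Real.sin x) univ x := fun x _ ↦
    (((legendrePoly l).hasDerivAt _).comp x (Real.hasDerivAt_cos x)).hasDerivWithinAt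
  have hb : ∀ x ∈ (univ : Set ℝ),
      ‖(derivative (legendrePoly l)).eval (Real.cos x) * -Real.sin x‖ ≤ 2 * l := by
    intro x _
    have h := legendre_bernstein l (Real.cos_mem_Icc x)
    rw [Real.norm_eq_abs]
    apply abs_le_of_sq_le_sq _ (by positivity)
    rw [← Real.sin_sq] at h
    have hl : (l : ℝ) ≤ l ^ 2 := by exact_mod_cast Nat.le_self_pow two_ne_zero l
    nlinarith
  have := convex_univ.norm_image_sub_le_of_norm_hasDerivWithin_le hd hb (mem_univ b) (mem_univ a)
  simpa [eval_legendrePoly] using this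

/-! ### Rotations and the divergence theorem on the sphere -/

instance : IsFiniteMeasure surface := inferInstanceAs (IsFiniteMeasure (volume : Measure E3).toSphere)

lemma surface_real_univ : surface.real univ = 4 * Real.pi := by
  rw [surface, Measure.toSphere_real_apply_univ, measureReal_def, EuclideanSpace.volume_ball_fin_three]
  simp
  rw [ENNReal.toReal_ofReal (by positivity)]
  ring

lemma continuous_rotate (R : E3 ≃ₗᵢ[ℝ] E3) : Continuous (rotate R) :=
  Continuous.subtype_mk (R.continuous.comp continuous_subtype_val) _

lemma measurePreserving_rotate (R : E3 ≃ₗᵢ[ℝ] E3) :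
    MeasurePreserving (rotate R) surface surface := by
  refine ⟨(continuous_rotate R).measurable, ?_⟩
  ext s hs
  rw [Measure.map_apply (continuous_rotate R).measurable hs, surface,
    Measure.toSphere_apply' _ hs,
    Measure.toSphere_apply' _ ((continuous_rotate R).measurable hs)]
  congr 1
  -- The surface measure of a set is a multiple of the volume of the cone over it, and forming cones
  -- commutes with linear isometries.
  have : Ioo (0 : ℝ) 1 • (Subtype.val '' (rotate R ⁻¹' s)) =
      R ⁻¹' (Ioo (0 : ℝ) 1 • (Subtype.val '' s)) := by
    ext x
    simp only [Set.mem_smul, mem_preimage, mem_image]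
    constructor
    · rintro ⟨r, hr, _, ⟨y, hy, rfl⟩, rfl⟩
      exact ⟨r, hr, _, ⟨rotate R y, hy, rfl⟩, by simp [rotate]⟩
    · rintro ⟨r, hr, _, ⟨y, hy, rfl⟩, h⟩
      refine ⟨r, hr, _, ⟨rotate R.symm y, ?_, rfl⟩, ?_⟩
      · have : rotate R (rotate R.symm y) = y := by
          ext1; simp [rotate]
        rwa [this]
      · apply R.injective
        rw [← h]
        simp [rotate]
  rw [this]
  exact R.measurePreserving.measure_preimage_emb R.toHomeomorph.measurableEmbedding _

/-- The rotation by the angle `θ` in the plane spanned by two orthonormal vectors. -/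
def planeRotationMap (e f : E3) (θ : ℝ) : E3 →ₗ[ℝ] E3 :=
  LinearMap.id + (Real.cos θ - 1) • (((innerₛₗ ℝ e).smulRight e) + ((innerₛₗ ℝ f).smulRight f)) +
    Real.sin θ • (((innerₛₗ ℝ e).smulRight f) - ((innerₛₗ ℝ f).smulRight e))

lemma planeRotationMap_apply (e f : E3) (θ : ℝ) (y : E3) :
    planeRotationMap e f θ y = y + (Real.cos θ - 1) • (inner ℝ e y • e + inner ℝ f y • f) +
      Real.sin θ • (inner ℝ e y • f - inner ℝ f y • e) := by
  simp [planeRotationMap]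

/-- The rotation by the angle `θ` in the plane spanned by two orthonormal vectors, as an
isometry. -/
def planeRotation (e f : E3) (he : inner ℝ e e = 1) (hf : inner ℝ f f = 1) (hef : inner ℝ e f = 0)
    (θ : ℝ) : E3 ≃ₗᵢ[ℝ] E3 :=
  LinearIsometry.toLinearIsometryEquiv (F := E3)
    { toLinearMap := planeRotationMap e f θ
      norm_map' := by
        intro y
        have hfe : inner ℝ f e = 0 := by rw [real_inner_comm, hef]
        have h : inner ℝ (planeRotationMap e f θ y) (planeRotationMap e f θ y) = inner ℝ y y := by
          rw [planeRotationMap_apply]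
          simp only [inner_add_left, inner_add_right, inner_sub_left, inner_sub_right,
            real_inner_smul_left, real_inner_smul_right, he, hf, hef, hfe, real_inner_comm e y,
            real_inner_comm f y]
          have := Real.sin_sq_add_cos_sq θ
          linear_combination (inner ℝ e y ^ 2 + inner ℝ f y ^ 2) * this
        rw [real_inner_self_eq_norm_sq, real_inner_self_eq_norm_sq] at h
        exact (sq_eq_sq₀ (norm_nonneg _) (norm_nonneg _)).1 h } rfl

lemma planeRotation_apply (e f : E3) (he : inner ℝ e e = 1) (hf : inner ℝ f f = 1)
    (hef : inner ℝ e f = 0) (θ : ℝ) (y : E3) :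
    planeRotation e f he hf hef θ y = y +
      (Real.cos θ - 1) • (inner ℝ e y • e + inner ℝ f y • f) +
      Real.sin θ • (inner ℝ e y • f - inner ℝ f y • e) :=
  planeRotationMap_apply e f θ y

lemma integrable_of_continuous {F : S2 → ℝ} (hF : Continuous F) : Integrable F surface :=
  hF.integrable_of_hasCompactSupport (HasCompactSupport.of_compactSpace _)

/-- The integral of `F` over the sphere is unchanged when `F` is composed with the rotation by `θ`;
the claim is the derivative of this identity at `θ = 0`, where the velocity is `⟨e, y⟩ f - ⟨f, y⟩
e`. -/
lemma integral_fderiv_rotation_orthonormal {F : E3 → ℝ} (hF : ContDiff ℝ 1 F) {e f : E3}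
    (he : inner ℝ e e = 1) (hf : inner ℝ f f = 1) (hef : inner ℝ e f = 0) :
    ∫ y : S2, fderiv ℝ F y (inner ℝ e (y : E3) • f - inner ℝ f (y : E3) • e) ∂surface = 0 := by
  set ρ : ℝ → E3 → E3 := fun θ y ↦ y + (Real.cos θ - 1) • (inner ℝ e y • e + inner ℝ f y • f) +
      Real.sin θ • (inner ℝ e y • f - inner ℝ f y • e) with hρ
  set ρ' : ℝ → E3 → E3 := fun θ y ↦ (-Real.sin θ) • (inner ℝ e y • e + inner ℝ f y • f) +
      Real.cos θ • (inner ℝ e y • f - inner ℝ f y • e) with hρ'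
  have hρd : ∀ θ y, HasDerivAt (fun θ ↦ ρ θ y) (ρ' θ y) θ := fun θ y ↦
    ((((Real.hasDerivAt_cos θ).sub_const 1).smul_const _).const_add y).add
      ((Real.hasDerivAt_sin θ).smul_const _)
  have hF' : Continuous (fderiv ℝ F) := hF.continuous_fderiv one_ne_zero
  have hc : Continuous fun p : ℝ × S2 ↦ fderiv ℝ F (ρ p.1 p.2) (ρ' p.1 p.2) := by
    simp only [hρ, hρ']
    fun_prop
  obtain ⟨C, hC⟩ := (isCompact_Icc (a := (-1 : ℝ)) (b := 1)).prod (isCompact_univ (X := S2))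
    |>.exists_bound_of_continuousOn hc.continuousOn
  have hFc := hF.continuous
  have hdiff := (hF.differentiable one_ne_zero)
  have hρc : ∀ θ, Continuous fun y : S2 ↦ F (ρ θ y) := by
    intro θ
    simp only [hρ]
    fun_prop
  have key := (hasDerivAt_integral_of_dominated_loc_of_deriv_le (μ := surface) (𝕜 := ℝ) (x₀ := 0)
    (s := Icc (-1) 1) (F := fun θ (y : S2) ↦ F (ρ θ y))
    (F' := fun θ (y : S2) ↦ fderiv ℝ F (ρ θ y) (ρ' θ y)) (bound := fun _ ↦ C)
    (Icc_mem_nhds (by norm_num) (by norm_num))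
    (Eventually.of_forall fun θ ↦ (hρc θ).aestronglyMeasurable)
    (integrable_of_continuous (hρc 0))
    (hc.comp (Continuous.prodMk_right (0 : ℝ))).aestronglyMeasurable
    (Eventually.of_forall fun y θ hθ ↦ hC (θ, y) ⟨hθ, mem_univ _⟩) (integrable_const C)
    (Eventually.of_forall fun y θ _ ↦
      ((hdiff _).hasFDerivAt.comp_hasDerivAt θ (hρd θ y)))).2
  have hconst : (fun θ ↦ ∫ y : S2, F (ρ θ y) ∂surface) = fun _ ↦ ∫ y : S2, F y ∂surface := by
    funext θ
    have := (measurePreserving_rotate (planeRotation e f he hf hef θ)).integral_comp'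
      (f := (Homeomorph.mk ⟨rotate (planeRotation e f he hf hef θ),
        rotate (planeRotation e f he hf hef θ).symm, fun y ↦ by ext1; simp [rotate],
        fun y ↦ by ext1; simp [rotate]⟩ (continuous_rotate _)
        (continuous_rotate _)).toMeasurableEquiv) (fun y : S2 ↦ F y)
    rw [← this]
    apply integral_congr_ae
    refine Eventually.of_forall fun y ↦ ?_
    change F (ρ θ y) = F (planeRotation e f he hf hef θ y)
    rw [planeRotation_apply]
  rw [hconst] at key
  have h0 := key.unique (hasDerivAt_const _ _)
  rw [← h0]
  simp [hρ, hρ']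

/-- The vector field is bilinear in `e` and `f`, so an orthonormal basis suffices; equal basis
vectors give the zero field. -/
lemma integral_fderiv_rotation {F : E3 → ℝ} (hF : ContDiff ℝ 1 F) (e f : E3) :
    ∫ y : S2, fderiv ℝ F y (inner ℝ e (y : E3) • f - inner ℝ f (y : E3) • e) ∂surface = 0 := by
  have hF' : Continuous (fderiv ℝ F) := hF.continuous_fderiv one_ne_zero
  set b := EuclideanSpace.basisFun (Fin 3) ℝ
  have hb : ∀ i j, ∫ y : S2, fderiv ℝ F y
      (inner ℝ (b i) (y : E3) • b j - inner ℝ (b j) (y : E3) • b i) ∂surface = 0 := by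
    intro i j
    rcases eq_or_ne i j with rfl | h
    · simp
    · refine integral_fderiv_rotation_orthonormal hF ?_ ?_ ?_
      · simp
      · simp
      · exact b.orthonormal.2 h
  have hsum : ∀ y : S2, fderiv ℝ F y (inner ℝ e (y : E3) • f - inner ℝ f (y : E3) • e) =
      ∑ i, ∑ j, inner ℝ (b i) e * inner ℝ (b j) f * fderiv ℝ F y
        (inner ℝ (b i) (y : E3) • b j - inner ℝ (b j) (y : E3) • b i) := by
    intro y
    have h1 : inner ℝ e (y : E3) • f - inner ℝ f (y : E3) • e = ∑ i, ∑ j,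
        (inner ℝ (b i) e * inner ℝ (b j) f) •
        (inner ℝ (b i) (y : E3) • b j - inner ℝ (b j) (y : E3) • b i) := by
      have he := b.sum_repr' e
      have hf := b.sum_repr' f
      conv_lhs => rw [← he, ← hf]
      simp only [Fin.sum_univ_three, inner_add_left, real_inner_smul_left]
      module
    rw [h1]
    simp
  simp_rw [hsum]
  rw [integral_finsetSum _ fun i _ ↦ integrable_of_continuous (by fun_prop)]
  refine Finset.sum_eq_zero fun i _ ↦ ?_
  rw [integral_finsetSum _ fun i _ ↦ integrable_of_continuous (by fun_prop)]
  refine Finset.sum_eq_zero fun j _ ↦ ?_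
  rw [integral_const_mul, hb, mul_zero]

/-- The divergence theorem on the sphere, for the tangential part of a constant vector field. -/
lemma integral_divergence {F : E3 → ℝ} (hF : ContDiff ℝ 1 F) (v : E3) :
    ∫ y : S2, (fderiv ℝ F y v - inner ℝ v (y : E3) * fderiv ℝ F y y -
      2 * inner ℝ v (y : E3) * F y) ∂surface = 0 := by
  have hF' : Continuous (fderiv ℝ F) := hF.continuous_fderiv one_ne_zero
  have hFc := hF.continuous
  set b := EuclideanSpace.basisFun (Fin 3) ℝ
  have hG : ∀ i, ContDiff ℝ 1 fun y ↦ inner ℝ (b i) y * F y := fun i ↦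
    (contDiff_const.inner ℝ contDiff_id).mul hF
  have hd : ∀ i (y w : E3), fderiv ℝ (fun y ↦ inner ℝ (b i) y * F y) y w =
      inner ℝ (b i) w * F y + inner ℝ (b i) y * fderiv ℝ F y w := by
    intro i y w
    have h1 : HasFDerivAt (fun y : E3 ↦ inner ℝ (b i) y) (innerSL ℝ (b i)) y :=
      (innerSL ℝ (b i)).hasFDerivAt
    have h2 := (h1.mul ((hF.differentiable one_ne_zero) y).hasFDerivAt).fderiv
    rw [show (fun y ↦ inner ℝ (b i) y * F y) = (fun y ↦ inner ℝ (b i) y) * F from rfl, h2]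
    simp
    ring
  -- The tangential part `v - ⟨v, y⟩ y` is the sum of the rotation fields `⟨b i, y⟩ v - ⟨v, y⟩ b i`
  -- weighted by `⟨b i, y⟩`. Differentiating the weights contributes `(1 - 3) ⟨v, y⟩ F`, whence the
  -- factor 2.
  have hsum : ∀ y : S2, fderiv ℝ F y v - inner ℝ v (y : E3) * fderiv ℝ F y y -
      2 * inner ℝ v (y : E3) * F y = ∑ i, fderiv ℝ (fun y ↦ inner ℝ (b i) y * F y) y
        (inner ℝ (b i) (y : E3) • v - inner ℝ v (y : E3) • b i) := by
    intro y
    have hy : inner ℝ (y : E3) (y : E3) = 1 := by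
      rw [real_inner_self_eq_norm_sq]; simp
    have e1 : ∑ i, inner ℝ (b i) (y : E3) * inner ℝ (b i) (y : E3) = 1 := by
      have := b.sum_inner_mul_inner (y : E3) (y : E3)
      rw [hy] at this
      simpa only [real_inner_comm] using this
    have e2 : ∑ i, inner ℝ (b i) (y : E3) * inner ℝ (b i) v = inner ℝ v (y : E3) := by
      have := b.sum_inner_mul_inner (y : E3) v
      rw [real_inner_comm] at this
      rw [← this]
      exact Finset.sum_congr rfl fun i _ ↦ by rw [real_inner_comm]
    have e3 : ∑ i, inner ℝ (b i) (y : E3) * fderiv ℝ F y (b i) = fderiv ℝ F y y := by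
      have := congrArg (fderiv ℝ F y) (b.sum_repr' (y : E3))
      simpa only [map_sum, map_smul, smul_eq_mul] using this
    have hbb : ∀ i, inner ℝ (b i) (b i) = (1 : ℝ) := fun i ↦ by simp
    simp only [hd, map_sub, map_smul, smul_eq_mul, inner_sub_right, real_inner_smul_right, hbb]
    simp only [Fin.sum_univ_three] at e1 e2 e3 ⊢
    linear_combination -(F y) * e2 - fderiv ℝ F y v * e1 + inner ℝ v (y : E3) * e3
  simp_rw [hsum]
  rw [integral_finsetSum _ fun i _ ↦ integrable_of_continuous (by
    have := (hG i).continuous_fderiv one_ne_zero; fun_prop)]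
  exact Finset.sum_eq_zero fun i _ ↦ integral_fderiv_rotation (hG i) _ _

/-! ### Zonal integrals and the reproducing property of Legendre polynomials -/

@[fun_prop]
lemma continuous_dotS {α : Type*} [TopologicalSpace α] {f g : α → S2} (hf : Continuous f)
    (hg : Continuous g) : Continuous fun a ↦ dotS (f a) (g a) := by
  unfold dotS
  fun_prop

lemma dotS_comm (x y : S2) : dotS x y = dotS y x := real_inner_comm _ _

lemma dotS_self (x : S2) : dotS x x = 1 := by
  rw [dotS, real_inner_self_eq_norm_sq]
  simp

lemma dotS_mem_Icc (x y : S2) : dotS x y ∈ Icc (-1 : ℝ) 1 := by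
  have := abs_real_inner_le_norm (x : E3) (y : E3)
  simp only [norm_eq_of_mem_sphere, mul_one] at this
  exact abs_le.1 this

/-- The bilinear form `(p, q) ↦ ∫ p(⟨x, y⟩) q(⟨y, z⟩) dy`. -/
def zonalPairing (x z : S2) : ℝ[X] →ₗ[ℝ] ℝ[X] →ₗ[ℝ] ℝ :=
  LinearMap.mk₂ ℝ (fun p q ↦ ∫ y, p.eval (dotS x y) * q.eval (dotS y z) ∂surface)
    (fun p p' q ↦ by
      simp only [eval_add, add_mul]
      exact integral_add (integrable_of_continuous (by fun_prop))
        (integrable_of_continuous (by fun_prop)))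
    (fun c p q ↦ by
      simp only [eval_smul, smul_eq_mul, mul_assoc]
      exact integral_const_mul _ _)
    (fun p q q' ↦ by
      simp only [eval_add, mul_add]
      exact integral_add (integrable_of_continuous (by fun_prop))
        (integrable_of_continuous (by fun_prop)))
    (fun c p q ↦ by
      simp only [eval_smul, smul_eq_mul, mul_left_comm _ c]
      exact integral_const_mul _ _)

lemma zonalPairing_apply (x z : S2) (p q : ℝ[X]) :
    zonalPairing x z p q = ∫ y, p.eval (dotS x y) * q.eval (dotS y z) ∂surface := rfl

lemma zonalPairing_comm (x z : S2) (p q : ℝ[X]) : zonalPairing x z p q = zonalPairing z x q p := by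
  simp only [zonalPairing_apply, dotS_comm x, dotS_comm _ z]
  exact integral_congr_ae (Eventually.of_forall fun y ↦ mul_comm _ _)

lemma zonalPairing_C_mul_left (x z : S2) (c : ℝ) (p q : ℝ[X]) :
    zonalPairing x z (C c * p) q = c * zonalPairing x z p q := by
  rw [← smul_eq_C_mul, map_smul, LinearMap.smul_apply, smul_eq_mul]

lemma zonalPairing_C_mul_right (x z : S2) (c : ℝ) (p q : ℝ[X]) :
    zonalPairing x z p (C c * q) = c * zonalPairing x z p q := by
  rw [← smul_eq_C_mul, map_smul, smul_eq_mul]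

lemma contDiff_eval (p : ℝ[X]) : ContDiff ℝ 1 fun t ↦ p.eval t := by
  simpa [aeval_def, eval₂_eq_eval_map] using p.contDiff_aeval (𝕜 := ℝ) 1

/-- The divergence theorem for `F(y) = p(⟨x, y⟩) q(⟨z, y⟩)` and the constant field `x`. -/
lemma zonalPairing_divergence_left (x z : S2) (p q : ℝ[X]) :
    zonalPairing x z ((1 - X ^ 2) * derivative p) q + dotS x z * zonalPairing x z p (derivative q) -
      zonalPairing x z (X * p) (X * derivative q) - 2 * zonalPairing x z (X * p) q = 0 := by
  have hF : ContDiff ℝ 1 fun y : E3 ↦ p.eval (inner ℝ (x : E3) y) * q.eval (inner ℝ (z : E3) y) :=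
    ((contDiff_eval p).comp (contDiff_const.inner ℝ contDiff_id)).mul
      ((contDiff_eval q).comp (contDiff_const.inner ℝ contDiff_id))
  have hd : ∀ y w : E3, fderiv ℝ
      (fun y : E3 ↦ p.eval (inner ℝ (x : E3) y) * q.eval (inner ℝ (z : E3) y)) y w =
      (derivative p).eval (inner ℝ (x : E3) y) * inner ℝ (x : E3) w * q.eval (inner ℝ (z : E3) y) +
      p.eval (inner ℝ (x : E3) y) * ((derivative q).eval (inner ℝ (z : E3) y) *
        inner ℝ (z : E3) w) := by
    intro y w
    have h (p : ℝ[X]) (x : E3) : HasFDerivAt (fun y : E3 ↦ p.eval (inner ℝ x y))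
        ((derivative p).eval (inner ℝ x y) • innerSL ℝ x) y :=
      (p.hasDerivAt _).comp_hasFDerivAt y (innerSL ℝ x).hasFDerivAt
    have h2 := ((h p x).mul (h q z)).fderiv
    rw [show (fun y : E3 ↦ p.eval (inner ℝ (x : E3) y) * q.eval (inner ℝ (z : E3) y)) =
      (fun y : E3 ↦ p.eval (inner ℝ (x : E3) y)) * (fun y ↦ q.eval (inner ℝ (z : E3) y)) from rfl,
      h2]
    simp
    ring
  have key := integral_divergence hF (x : E3)
  simp only [hd] at key
  simp only [zonalPairing_apply, ← integral_const_mul]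
  rw [← integral_add (integrable_of_continuous (by fun_prop))
    (integrable_of_continuous (by fun_prop)), ← integral_sub (integrable_of_continuous (by fun_prop))
    (integrable_of_continuous (by fun_prop)), ← integral_sub (integrable_of_continuous (by fun_prop))
    (integrable_of_continuous (by fun_prop)), ← key]
  refine integral_congr_ae (Eventually.of_forall fun y ↦ ?_)
  have hx : inner ℝ (x : E3) (x : E3) = 1 := dotS_self x
  simp only [hx, dotS, real_inner_comm (z : E3) (y : E3), real_inner_comm (z : E3) (x : E3), eval_mul,
    eval_sub, eval_one, eval_pow, eval_X]
  ring

lemma zonalPairing_divergence_right (x z : S2) (p q : ℝ[X]) :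
    zonalPairing x z p ((1 - X ^ 2) * derivative q) + dotS x z * zonalPairing x z (derivative p) q -
      zonalPairing x z (X * derivative p) (X * q) - 2 * zonalPairing x z p (X * q) = 0 := by
  have := zonalPairing_divergence_left z x q p
  rwa [dotS_comm, zonalPairing_comm, zonalPairing_comm z x q, zonalPairing_comm z x (X * q),
    zonalPairing_comm z x (X * q)] at this

/-- The zonal form of the self-adjointness of the spherical Laplacian. -/
lemma zonalPairing_laplacian (x z : S2) (p q : ℝ[X]) :
    zonalPairing x z ((1 - X ^ 2) * derivative (derivative p) - 2 * X * derivative p) q =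
      zonalPairing x z p ((1 - X ^ 2) * derivative (derivative q) - 2 * X * derivative q) := by
  -- Both divergence identities contain the same mixed terms in `p'` and `q'`, which cancel in the
  -- difference.
  have h1 := zonalPairing_divergence_left x z (derivative p) q
  have h2 := zonalPairing_divergence_right x z p (derivative q)
  rw [map_sub, map_sub, LinearMap.sub_apply, mul_assoc, mul_assoc,
    show (2 : ℝ[X]) = C 2 from rfl, zonalPairing_C_mul_left, zonalPairing_C_mul_right]
  linear_combination h1 - h2

/-- Eigenfunctions of a symmetric operator for the distinct eigenvalues `-l(l+1)` and `-m(m+1)`; the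
difference factors as `(l - m)(l + m + 1)`. -/
lemma zonalPairing_legendre_of_ne (x z : S2) {l m : ℕ} (h : l ≠ m) :
    zonalPairing x z (legendrePoly l) (legendrePoly m) = 0 := by
  have key := zonalPairing_laplacian x z (legendrePoly l) (legendrePoly m)
  rw [legendrePoly_ode, legendrePoly_ode, map_neg, map_neg, LinearMap.neg_apply,
    zonalPairing_C_mul_left, zonalPairing_C_mul_right] at key
  have h2 : ((l : ℝ) - m) * (l + m + 1) ≠ 0 := by
    apply mul_ne_zero
    · rw [sub_ne_zero]; exact_mod_cast h
    · positivity
  apply (mul_eq_zero.1 (_ : (((l : ℝ) - m) * (l + m + 1)) * _ = 0)).resolve_left h2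
  linear_combination -key

/-- The Legendre polynomials span the polynomials. -/
lemma exists_eq_sum_legendrePoly (n : ℕ) (q : ℝ[X]) (hq : q.degree < n) :
    ∃ c : ℕ → ℝ, q = ∑ m ∈ Finset.range n, C (c m) * legendrePoly m := by
  induction n generalizing q with
  | zero =>
    refine ⟨0, ?_⟩
    ext k
    simpa using (degree_lt_iff_coeff_zero _ _).1 hq k (Nat.zero_le k)
  | succ n ih =>
    have hlead : (legendrePoly n).coeff n ≠ 0 := by
      have h0 : legendrePoly n ≠ 0 := by
        intro h
        have := eval_legendrePoly n 1
        rw [h, legendre_one] at this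
        simp at this
      have := leadingCoeff_ne_zero.2 h0
      rwa [leadingCoeff, natDegree_legendrePoly] at this
    set a := q.coeff n / (legendrePoly n).coeff n
    obtain ⟨c, hc⟩ := ih (q - C a * legendrePoly n) (by
      rw [degree_lt_iff_coeff_zero]
      intro k hk
      rw [coeff_sub, coeff_C_mul]
      rcases hk.eq_or_lt with rfl | hk
      · simp [a, div_mul_cancel₀ _ hlead]
      · rw [(degree_lt_iff_coeff_zero _ _).1 hq k hk,
          coeff_eq_zero_of_natDegree_lt (by rwa [natDegree_legendrePoly])]
        simp)
    refine ⟨Function.update c n a, ?_⟩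
    rw [Finset.sum_range_succ, Function.update_self, Finset.sum_congr rfl fun m hm ↦ by
      rw [Function.update_of_ne (Finset.mem_range.1 hm).ne], ← hc]
    ring

lemma zonalPairing_legendre_of_degree_lt (x z : S2) {l : ℕ} {q : ℝ[X]} (hq : q.degree < l) :
    zonalPairing x z (legendrePoly l) q = 0 := by
  obtain ⟨c, rfl⟩ := exists_eq_sum_legendrePoly l q hq
  rw [map_sum]
  refine Finset.sum_eq_zero fun m hm ↦ ?_
  rw [zonalPairing_C_mul_right, zonalPairing_legendre_of_ne x z (Finset.mem_range.1 hm).ne', mul_zero]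

/-- The divergence identity for `X ^ (n + 1)` and `1` relates the moments `n` and `n + 2`: `(n + 1)
Iₙ = (n + 3) Iₙ₊₂`. -/
lemma zonalPairing_pow_one (x z : S2) (n : ℕ) :
    zonalPairing x z (X ^ n) 1 = 2 * Real.pi * (1 + (-1) ^ n) / (n + 1) := by
  induction n using Nat.twoStepInduction with
  | zero =>
    simp [zonalPairing_apply, surface_real_univ]
    ring
  | one =>
    have := zonalPairing_divergence_left x z 1 1
    simpa using this
  | more n h _ =>
    have := zonalPairing_divergence_left x z (X ^ (n + 1)) 1
    simp only [derivative_X_pow, derivative_one, mul_zero, map_zero, add_tsub_cancel_right] at this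
    rw [show (1 - X ^ 2) * (C ((n + 1 : ℕ) : ℝ) * X ^ n : ℝ[X]) =
      C ((n + 1 : ℕ) : ℝ) * (X ^ n - X ^ (n + 2)) by ring, zonalPairing_C_mul_left, map_sub,
      LinearMap.sub_apply, h, show (X * X ^ (n + 1) : ℝ[X]) = X ^ (n + 2) by ring] at this
    have h1 : (n : ℝ) + 1 ≠ 0 := by positivity
    have h3 : ((n + 2 : ℕ) : ℝ) + 1 ≠ 0 := by positivity
    rw [eq_div_iff h3]
    push_cast at this ⊢
    field_simp at this
    linear_combination -this

/-- Archimedes' theorem: the height `⟨x, y⟩` has density `2π` on `[-1, 1]`. -/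
lemma zonalPairing_derivative_one (x z : S2) (p : ℝ[X]) :
    zonalPairing x z (derivative p) 1 = 2 * Real.pi * (p.eval 1 - p.eval (-1)) := by
  induction p using Polynomial.induction_on' with
  | add p q hp hq =>
    rw [derivative_add, map_add, LinearMap.add_apply, hp, hq, eval_add, eval_add]
    ring
  | monomial n a =>
    rw [derivative_monomial]
    rcases n with _ | n
    · simp
    · rw [← C_mul_X_pow_eq_monomial, zonalPairing_C_mul_left, add_tsub_cancel_right,
        zonalPairing_pow_one]
      have h1 : (n : ℝ) + 1 ≠ 0 := by positivity
      simp only [eval_monomial, one_pow]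
      push_cast
      field_simp
      ring

lemma zonalPairing_self_mul (x : S2) (p q : ℝ[X]) :
    zonalPairing x x p q = zonalPairing x x (p * q) 1 := by
  simp only [zonalPairing_apply, eval_mul, eval_one, mul_one, dotS_comm _ x]

/-- Integrate `(X P²)' = (2l + 1) P² + 2 P (X P' - l P)`. The leading terms in `X P' - l P` cancel,
so that factor has degree below `l` and is orthogonal to `P`; the boundary terms give `4π`. -/
lemma zonalPairing_legendre_self (x : S2) (l : ℕ) :
    zonalPairing x x (legendrePoly l) (legendrePoly l) = 4 * Real.pi / (2 * l + 1) := by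
  have h := zonalPairing_derivative_one x x (X * legendrePoly l ^ 2)
  have hdeg : (X * derivative (legendrePoly l) - C (l : ℝ) * legendrePoly l).degree < (l : WithBot ℕ) := by
    rw [degree_lt_iff_coeff_zero]
    intro k hk
    rw [coeff_sub, coeff_C_mul]
    have : (X * derivative (legendrePoly l)).coeff k = k * (legendrePoly l).coeff k := by
      rcases k with _ | k
      · simp
      · rw [coeff_X_mul, coeff_derivative]; push_cast; ring
    rw [this]
    rcases hk.eq_or_lt with rfl | hk
    · simp
    · rw [coeff_eq_zero_of_natDegree_lt (by rwa [natDegree_legendrePoly])]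
      simp
  have h0 := zonalPairing_legendre_of_degree_lt x x hdeg
  have e : derivative (X * legendrePoly l ^ 2) = C (2 * (l : ℝ) + 1) *
      (legendrePoly l * legendrePoly l) + C 2 * (legendrePoly l *
      (X * derivative (legendrePoly l) - C (l : ℝ) * legendrePoly l)) := by
    simp only [derivative_mul, derivative_X, derivative_pow, C_add, C_mul, C_1, Nat.cast_ofNat]
    ring
  rw [e, map_add, LinearMap.add_apply, zonalPairing_C_mul_left, zonalPairing_C_mul_left,
    ← zonalPairing_self_mul, ← zonalPairing_self_mul, h0] at h
  simp only [eval_mul, eval_X, eval_pow, eval_legendrePoly, legendre_neg, legendre_one, mul_one,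
    ← pow_mul, one_pow] at h
  rw [mul_comm l 2, pow_mul, neg_one_sq, one_pow] at h
  rw [eq_div_iff (by positivity)]
  linarith

/-- The divergence identity gives `(a + b + 2) I(a + 1, b) = a I(a - 1, b) + b ⟨x, z⟩ I(a, b - 1)`,
a recursion on the first exponent. -/
lemma exists_zonalPairing_pow_eq_eval (a b : ℕ) :
    ∃ w : ℝ[X], ∀ x z : S2, zonalPairing x z (X ^ a) (X ^ b) = w.eval (dotS x z) := by
  induction a using Nat.strong_induction_on generalizing b with
  | _ a ih =>
  rcases a with _ | a
  · exact ⟨C (2 * Real.pi * (1 + (-1) ^ b) / (b + 1)), fun x z ↦ by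
      rw [zonalPairing_comm, pow_zero, zonalPairing_pow_one, eval_C]⟩
  -- Truncation at zero in `a - 1` and `b - 1` is harmless: those terms carry the factors `a` and
  -- `b`.
  · obtain ⟨w₁, h₁⟩ := ih (a - 1) (by omega) b
    obtain ⟨w₂, h₂⟩ := ih a (by omega) (b - 1)
    refine ⟨C (((a : ℝ) + b + 2)⁻¹) * (C (a : ℝ) * w₁ + C (b : ℝ) * (X * w₂)), fun x z ↦ ?_⟩
    have := zonalPairing_divergence_left x z (X ^ a) (X ^ b)
    have e1 : (1 - X ^ 2) * (C (a : ℝ) * X ^ (a - 1) : ℝ[X]) =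
        C (a : ℝ) * (X ^ (a - 1) - X ^ (a + 1)) := by
      rcases a with _ | a
      · simp
      · simp only [add_tsub_cancel_right]; ring
    have e2 : X * (C (b : ℝ) * X ^ (b - 1) : ℝ[X]) = C (b : ℝ) * X ^ b := by
      rcases b with _ | b
      · simp
      · simp only [add_tsub_cancel_right]; ring
    rw [derivative_X_pow, derivative_X_pow, e1, e2, zonalPairing_C_mul_left, map_sub,
      LinearMap.sub_apply, zonalPairing_C_mul_right, zonalPairing_C_mul_right, h₁, h₂,
      show (X * X ^ a : ℝ[X]) = X ^ (a + 1) by ring] at this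
    have h2 : (a : ℝ) + b + 2 ≠ 0 := by positivity
    simp only [eval_mul, eval_C, eval_add, eval_X]
    rw [eq_inv_mul_iff_mul_eq₀ h2]
    linear_combination -this

lemma exists_zonalPairing_eq_eval (p q : ℝ[X]) :
    ∃ w : ℝ[X], ∀ x z : S2, zonalPairing x z p q = w.eval (dotS x z) := by
  induction p using Polynomial.induction_on' with
  | add p p' hp hp' =>
    obtain ⟨w, hw⟩ := hp
    obtain ⟨w', hw'⟩ := hp'
    exact ⟨w + w', fun x z ↦ by rw [map_add, LinearMap.add_apply, hw, hw', eval_add]⟩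
  | monomial n a =>
    induction q using Polynomial.induction_on' with
    | add q q' hp hp' =>
      obtain ⟨w, hw⟩ := hp
      obtain ⟨w', hw'⟩ := hp'
      exact ⟨w + w', fun x z ↦ by rw [map_add, hw, hw', eval_add]⟩
    | monomial m b =>
      obtain ⟨w, hw⟩ := exists_zonalPairing_pow_eq_eval n m
      refine ⟨C a * (C b * w), fun x z ↦ ?_⟩
      rw [← C_mul_X_pow_eq_monomial, ← C_mul_X_pow_eq_monomial, zonalPairing_C_mul_left,
        zonalPairing_C_mul_right, hw]
      simp

instance : Nonempty S2 := (NormedSpace.sphere_nonempty.2 zero_le_one).to_subtype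

/-- The reproducing property of the Legendre polynomials. -/
lemma zonalPairing_legendre_same (x z : S2) (l : ℕ) :
    zonalPairing x z (legendrePoly l) (legendrePoly l) =
      4 * Real.pi / (2 * l + 1) * legendre l (dotS x z) := by
  obtain ⟨φ, hφ⟩ := exists_zonalPairing_eq_eval (legendrePoly l) (legendrePoly l)
  obtain ⟨c, hc⟩ := exists_eq_sum_legendrePoly (max (l + 1) (φ.natDegree + 1)) φ
    (degree_le_natDegree.trans_lt (by exact_mod_cast (by omega)))
  have hpos : ∀ m : ℕ, 4 * Real.pi / (2 * (m : ℝ) + 1) ≠ 0 := fun m ↦ by positivity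
  have hzero : ∀ m, m ≠ l → m ∈ Finset.range (max (l + 1) (φ.natDegree + 1)) → c m = 0 := by
    intro m hm hmem
    have h1 : zonalPairing x x φ (legendrePoly m) = c m * (4 * Real.pi / (2 * m + 1)) := by
      rw [hc, map_sum, LinearMap.sum_apply, Finset.sum_eq_single m]
      · rw [zonalPairing_C_mul_left, zonalPairing_legendre_self]
      · intro k _ hk
        rw [zonalPairing_C_mul_left, zonalPairing_legendre_of_ne x x hk, mul_zero]
      · exact fun h ↦ absurd hmem h
    -- Write `φ` as an integral over a third point `w` and apply Fubini: the inner integral pairs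
    -- `legendrePoly l` with `legendrePoly m` between `w` and `x`, and vanishes. Hence `φ` has only
    -- a component of index `l`.
    have h2 : zonalPairing x x φ (legendrePoly m) = 0 := by
      rw [zonalPairing_apply]
      simp_rw [← hφ, zonalPairing_apply, ← integral_mul_const]
      rw [integral_integral_swap]
      · have : ∀ w, ∫ y, (legendrePoly l).eval (dotS x w) * (legendrePoly l).eval (dotS w y) *
            (legendrePoly m).eval (dotS y x) ∂surface = 0 := by
          intro w
          simp_rw [mul_assoc]
          rw [integral_const_mul, ← zonalPairing_apply, zonalPairing_legendre_of_ne w x hm.symm,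
            mul_zero]
        simp [this]
      · refine Continuous.integrable_of_hasCompactSupport ?_ (HasCompactSupport.of_compactSpace _)
        simp only [Function.uncurry_def]
        fun_prop
    rw [h1] at h2
    exact (mul_eq_zero.1 h2).resolve_right (hpos m)
  have hφl : φ = C (c l) * legendrePoly l := by
    rw [hc]
    refine Finset.sum_eq_single l (fun m hm hml ↦ by rw [hzero m hml hm]; simp) fun h ↦ ?_
    exact absurd (Finset.mem_range.2 (by omega)) h
  -- Evaluation on the diagonal, where the Legendre polynomial is 1, determines the remaining
  -- coefficient.
  have hcl : c l = 4 * Real.pi / (2 * l + 1) := by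
    have := hφ x x
    rw [zonalPairing_legendre_self, hφl, dotS_self, eval_mul, eval_C, eval_legendrePoly,
      legendre_one, mul_one] at this
    exact this.symm
  rw [hφ, hφl, hcl, eval_mul, eval_C, eval_legendrePoly]

@[fun_prop]
lemma continuous_legendre (l : ℕ) : Continuous (legendre l) := by
  have : legendre l = fun t ↦ (legendrePoly l).eval t := by
    funext t; rw [eval_legendrePoly]
  rw [this]
  fun_prop

lemma integral_legendre_mul_legendre (x z : S2) (l m : ℕ) :
    ∫ y, legendre l (dotS x y) * legendre m (dotS y z) ∂surface =
      if l = m then 4 * Real.pi / (2 * l + 1) * legendre l (dotS x z) else 0 := by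
  simp_rw [← eval_legendrePoly, ← zonalPairing_apply]
  split_ifs with h
  · subst h
    rw [zonalPairing_legendre_same, eval_legendrePoly]
  · exact zonalPairing_legendre_of_ne x z h

/-! ### Smoothing as an operator on functions on the sphere -/

@[fun_prop]
lemma continuous_smoothingKernel (L : ℕ) (κ : ℕ → ℝ) : Continuous (smoothingKernel L κ) := by
  unfold smoothingKernel
  fun_prop

lemma smoothingKernel_congr {L : ℕ} {κ μ : ℕ → ℝ} (h : ∀ l ≤ L, κ l = μ l) :
    smoothingKernel L κ = smoothingKernel L μ := by
  funext t
  exact Finset.sum_congr rfl fun l hl ↦ by rw [h l (Nat.lt_succ_iff.1 (Finset.mem_range.1 hl))]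

lemma smoothingKernel_sub (L : ℕ) (κ μ : ℕ → ℝ) (t : ℝ) :
    smoothingKernel L (fun l ↦ κ l - μ l) t = smoothingKernel L κ t - smoothingKernel L μ t := by
  simp only [smoothingKernel, ← Finset.sum_sub_distrib]
  exact Finset.sum_congr rfl fun l _ ↦ by ring

lemma smoothingKernel_const_mul (L : ℕ) (c : ℝ) (κ : ℕ → ℝ) (t : ℝ) :
    smoothingKernel L (fun l ↦ c * κ l) t = c * smoothingKernel L κ t := by
  simp only [smoothingKernel, Finset.mul_sum]
  exact Finset.sum_congr rfl fun l _ ↦ by ring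

/-- The convolution theorem: the weight `(2l + 1)/(4π)` cancels the constant of the reproducing
property, so coefficients simply multiply. -/
lemma integral_smoothingKernel_mul (L : ℕ) (κ μ : ℕ → ℝ) (x z : S2) :
    ∫ y, smoothingKernel L κ (dotS x y) * smoothingKernel L μ (dotS y z) ∂surface =
      smoothingKernel L (fun l ↦ κ l * μ l) (dotS x z) := by
  simp only [smoothingKernel, Finset.sum_mul_sum]
  rw [integral_finsetSum _ fun l _ ↦ integrable_of_continuous (by fun_prop)]
  refine Finset.sum_congr rfl fun l hl ↦ ?_
  rw [integral_finsetSum _ fun l _ ↦ integrable_of_continuous (by fun_prop),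
    Finset.sum_eq_single l]
  · have : ∀ y, (2 * (l : ℝ) + 1) / (4 * Real.pi) * κ l * legendre l (dotS x y) *
        ((2 * (l : ℝ) + 1) / (4 * Real.pi) * μ l * legendre l (dotS y z)) =
        ((2 * (l : ℝ) + 1) / (4 * Real.pi) * κ l * ((2 * (l : ℝ) + 1) / (4 * Real.pi) * μ l)) *
          (legendre l (dotS x y) * legendre l (dotS y z)) := fun y ↦ by ring
    simp_rw [this]
    rw [integral_const_mul, integral_legendre_mul_legendre, if_pos rfl]
    have h1 : (2 * (l : ℝ) + 1) ≠ 0 := by positivity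
    have h2 := Real.pi_ne_zero
    field_simp
  · intro m _ hm
    have : ∀ y, (2 * (l : ℝ) + 1) / (4 * Real.pi) * κ l * legendre l (dotS x y) *
        ((2 * (m : ℝ) + 1) / (4 * Real.pi) * μ m * legendre m (dotS y z)) =
        ((2 * (l : ℝ) + 1) / (4 * Real.pi) * κ l * ((2 * (m : ℝ) + 1) / (4 * Real.pi) * μ m)) *
          (legendre l (dotS x y) * legendre m (dotS y z)) := fun y ↦ by ring
    simp_rw [this]
    rw [integral_const_mul, integral_legendre_mul_legendre, if_neg hm.symm, mul_zero]
  · exact fun h ↦ absurd hl h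

/-- The convolution of a function on the sphere with the smoothing kernel. -/
def smoothing (L : ℕ) (κ : ℕ → ℝ) (h : S2 → ℝ) (x : S2) : ℝ :=
  ∫ y, smoothingKernel L κ (dotS x y) * h y ∂surface

lemma exists_smoothingKernel_bound (L : ℕ) (κ : ℕ → ℝ) :
    ∃ C, 0 ≤ C ∧ ∀ x y : S2, |smoothingKernel L κ (dotS x y)| ≤ C := by
  obtain ⟨C, hC⟩ := (isCompact_Icc (a := (-1 : ℝ)) (b := 1)).exists_bound_of_continuousOn
    (continuous_smoothingKernel L κ).continuousOn
  exact ⟨C, (norm_nonneg _).trans (hC 0 (by norm_num)), fun x y ↦ hC _ (dotS_mem_Icc x y)⟩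

lemma integrable_smoothingKernel_mul {L : ℕ} {κ : ℕ → ℝ} {h : S2 → ℝ} (hh : Integrable h surface)
    (x : S2) : Integrable (fun y ↦ smoothingKernel L κ (dotS x y) * h y) surface := by
  obtain ⟨C, _, hC⟩ := exists_smoothingKernel_bound L κ
  exact hh.bdd_mul (c := C) (Continuous.aestronglyMeasurable (by fun_prop))
    (Eventually.of_forall fun y ↦ hC x y)

@[fun_prop]
lemma continuous_smoothing {L : ℕ} {κ : ℕ → ℝ} {h : S2 → ℝ} (hh : Integrable h surface) :
    Continuous (smoothing L κ h) := by
  obtain ⟨C, _, hC⟩ := exists_smoothingKernel_bound L κ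
  refine continuous_of_dominated (bound := fun y ↦ C * |h y|)
    (fun x ↦ (integrable_smoothingKernel_mul hh x).aestronglyMeasurable)
    (fun x ↦ Eventually.of_forall fun y ↦ ?_) (hh.abs.const_mul C)
    (Eventually.of_forall fun y ↦ by fun_prop)
  rw [Real.norm_eq_abs, abs_mul]
  exact mul_le_mul_of_nonneg_right (hC x y) (abs_nonneg _)

lemma integrable_prod_smoothingKernel {L : ℕ} {κ : ℕ → ℝ} {F : S2 × S2 → ℝ}
    (hF : Integrable F (surface.prod surface)) :
    Integrable (fun p ↦ smoothingKernel L κ (dotS p.1 p.2) * F p) (surface.prod surface) := by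
  obtain ⟨C, _, hC⟩ := exists_smoothingKernel_bound L κ
  exact hF.bdd_mul (c := C) (Continuous.aestronglyMeasurable (by fun_prop))
    (Eventually.of_forall fun y ↦ hC y.1 y.2)

lemma smoothing_smoothing {L : ℕ} (κ μ : ℕ → ℝ) {h : S2 → ℝ} (hh : Integrable h surface) (x : S2) :
    smoothing L κ (smoothing L μ h) x = smoothing L (fun l ↦ κ l * μ l) h x := by
  simp only [smoothing, ← integral_const_mul]
  rw [integral_integral_swap]
  · refine integral_congr_ae (Eventually.of_forall fun z ↦ ?_)
    simp only [← mul_assoc]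
    rw [integral_mul_const, integral_smoothingKernel_mul]
  · have h1 : Integrable (fun p : S2 × S2 ↦ smoothingKernel L κ (dotS x p.1) * h p.2)
        (surface.prod surface) :=
      (integrable_of_continuous (F := fun y ↦ smoothingKernel L κ (dotS x y))
        (by fun_prop)).mul_prod hh
    refine (integrable_prod_smoothingKernel (L := L) (κ := μ) h1).congr
      (Eventually.of_forall fun p ↦ ?_)
    simp only [Function.uncurry]
    ring

lemma integral_smoothing_mul {L : ℕ} (κ : ℕ → ℝ) {g h : S2 → ℝ} (hg : Integrable g surface)
    (hh : Integrable h surface) :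
    ∫ x, smoothing L κ g x * h x ∂surface = ∫ x, g x * smoothing L κ h x ∂surface := by
  simp only [smoothing, ← integral_const_mul, ← integral_mul_const]
  rw [integral_integral_swap]
  · refine integral_congr_ae (Eventually.of_forall fun z ↦ ?_)
    refine integral_congr_ae (Eventually.of_forall fun y ↦ ?_)
    simp only [dotS_comm z y]
    ring
  · refine (integrable_prod_smoothingKernel (L := L) (κ := κ) (hh.mul_prod hg)).congr
      (Eventually.of_forall fun p ↦ ?_)
    simp only [Function.uncurry]
    ring

lemma smoothing_const_mul (L : ℕ) (c : ℝ) (κ : ℕ → ℝ) (h : S2 → ℝ) (x : S2) :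
    smoothing L (fun l ↦ c * κ l) h x = c * smoothing L κ h x := by
  simp only [smoothing, smoothingKernel_const_mul, mul_assoc, integral_const_mul]

lemma smoothing_sub (L : ℕ) (κ μ : ℕ → ℝ) {h : S2 → ℝ} (hh : Integrable h surface) (x : S2) :
    smoothing L (fun l ↦ κ l - μ l) h x = smoothing L κ h x - smoothing L μ h x := by
  simp only [smoothing, smoothingKernel_sub, sub_mul]
  exact integral_sub (integrable_smoothingKernel_mul hh x) (integrable_smoothingKernel_mul hh x)

lemma integral_smoothing_sq {L : ℕ} (κ : ℕ → ℝ) {h : S2 → ℝ} (hh : Integrable h surface) :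
    ∫ x, smoothing L κ h x ^ 2 ∂surface =
      ∫ x, h x * smoothing L (fun l ↦ κ l * κ l) h x ∂surface := by
  simp only [sq]
  rw [integral_smoothing_mul κ hh (integrable_of_continuous (continuous_smoothing hh))]
  simp only [smoothing_smoothing κ κ hh]

lemma integrable_mul_continuous {g h : S2 → ℝ} (hh : Integrable h surface) (hg : Continuous g) :
    Integrable (fun x ↦ h x * g x) surface := by
  obtain ⟨C, hC⟩ := isCompact_univ.exists_bound_of_continuousOn hg.continuousOn
  exact hh.mul_bdd (c := C) hg.aestronglyMeasurable
    (Eventually.of_forall fun y ↦ hC y (mem_univ y))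

/-- Smoothing is bounded on `L²` by the largest coefficient of the kernel. -/
lemma integral_smoothing_sq_le {L : ℕ} {κ : ℕ → ℝ} {M : ℝ} (hκ : ∀ l ≤ L, |κ l| ≤ M) {h : S2 → ℝ}
    (hh : MemLp h 2 surface) :
    ∫ x, smoothing L κ h x ^ 2 ∂surface ≤ M ^ 2 * ∫ x, h x ^ 2 ∂surface := by
  have hi : Integrable h surface := hh.integrable (by norm_num)
  have hint : ∀ μ : ℕ → ℝ, Integrable (fun x ↦ h x * smoothing L μ h x) surface := fun μ ↦
    integrable_mul_continuous hi (continuous_smoothing hi)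
  -- With all coefficients 1, smoothing is a self-adjoint projection `Π`; expand `0 ≤ ‖h - Π h‖²`,
  -- using `‖Π h‖² = ⟨h, Π h⟩`.
  have h1 : ∫ x, h x * smoothing L (fun _ ↦ 1) h x ∂surface ≤ ∫ x, h x ^ 2 ∂surface := by
    have hsq := integral_smoothing_sq (L := L) (fun _ ↦ 1) hi
    have hnn : 0 ≤ ∫ x, (h x - smoothing L (fun _ ↦ 1) h x) ^ 2 ∂surface :=
      integral_nonneg fun x ↦ sq_nonneg _
    have hexp : ∀ x, (h x - smoothing L (fun _ ↦ 1) h x) ^ 2 = h x ^ 2 -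
      2 * (h x * smoothing L (fun _ ↦ 1) h x) + smoothing L (fun _ ↦ 1) h x ^ 2 := fun x ↦ by ring
    simp_rw [hexp] at hnn
    have i1 : Integrable (fun x ↦ h x ^ 2 - 2 * (h x * smoothing L (fun _ ↦ 1) h x)) surface :=
      hh.integrable_sq.sub ((hint _).const_mul 2)
    have i2 : Integrable (fun x ↦ smoothing L (fun _ ↦ 1) h x ^ 2) surface :=
      integrable_of_continuous ((continuous_smoothing hi).pow 2)
    rw [integral_add i1 i2, integral_sub hh.integrable_sq ((hint _).const_mul 2), integral_const_mul, hsq] at hnn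
    simp only [mul_one] at hnn
    linarith
  -- The operator with coefficients `M² - κ²` is positive, being the square of the one with
  -- coefficients `√(M² - κ²)`.
  have h2 : ∫ x, h x * smoothing L (fun l ↦ κ l * κ l) h x ∂surface ≤
      ∫ x, h x * smoothing L (fun _ ↦ M ^ 2 * 1) h x ∂surface := by
    have hs := integral_smoothing_sq (L := L) (fun l ↦ √(M ^ 2 * 1 - κ l * κ l)) hi
    have hnn : 0 ≤ ∫ x, smoothing L (fun l ↦ √(M ^ 2 * 1 - κ l * κ l)) h x ^ 2 ∂surface :=
      integral_nonneg fun x ↦ sq_nonneg _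
    have hc : smoothing L (fun l ↦ √(M ^ 2 * 1 - κ l * κ l) * √(M ^ 2 * 1 - κ l * κ l)) h =
        smoothing L (fun l ↦ M ^ 2 * 1 - κ l * κ l) h := by
      funext x
      simp only [smoothing]
      rw [smoothingKernel_congr fun l hl ↦ Real.mul_self_sqrt ?_]
      have := sq_le_sq' (by linarith [neg_abs_le (κ l), hκ l hl]) ((le_abs_self _).trans (hκ l hl))
      linarith
    rw [hs, hc] at hnn
    simp only [smoothing_sub L _ _ hi, mul_sub] at hnn
    rw [integral_sub (hint _) (hint _)] at hnn
    linarith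
  rw [integral_smoothing_sq κ hi]
  refine h2.trans ?_
  simp only [smoothing_const_mul, mul_left_comm _ (M ^ 2)]
  rw [integral_const_mul]
  exact mul_le_mul_of_nonneg_left h1 (sq_nonneg M)

/-! ### Geodesic distance and the Lipschitz bound -/

lemma geoDist_eq_angle (x y : S2) : geoDist x y = InnerProductGeometry.angle (x : E3) (y : E3) := by
  simp [geoDist, dotS, InnerProductGeometry.angle]

lemma geoDist_comm (x y : S2) : geoDist x y = geoDist y x := by
  rw [geoDist, geoDist, dotS_comm]

lemma geoDist_nonneg (x y : S2) : 0 ≤ geoDist x y := Real.arccos_nonneg _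

lemma geoDist_triangle (x y z : S2) : geoDist x z ≤ geoDist x y + geoDist y z := by
  simp only [geoDist_eq_angle]
  exact InnerProductGeometry.angle_le_angle_add_angle _ _ _

lemma cos_geoDist (x y : S2) : Real.cos (geoDist x y) = dotS x y :=
  Real.cos_arccos (dotS_mem_Icc x y).1 (dotS_mem_Icc x y).2

/-- Each Legendre term is Lipschitz in the angle to `y`, and by the triangle inequality that angle
changes by at most the distance of `x₁` and `x₂`. This is the source of `L³`. -/
lemma abs_smoothingKernel_sub_le {L : ℕ} {κ : ℕ → ℝ} {M : ℝ} (hκ : ∀ l ≤ L, |κ l| ≤ M)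
    (x₁ x₂ y : S2) :
    |smoothingKernel L κ (dotS x₁ y) - smoothingKernel L κ (dotS x₂ y)| ≤
      M * L ^ 3 * geoDist x₁ x₂ := by
  have hM : 0 ≤ M := (abs_nonneg _).trans (hκ 0 (Nat.zero_le L))
  have hd : |geoDist x₁ y - geoDist x₂ y| ≤ geoDist x₁ x₂ := by
    rw [abs_le]
    have h1 := geoDist_triangle x₁ x₂ y
    have h2 := geoDist_triangle x₂ x₁ y
    rw [geoDist_comm x₂ x₁] at h2
    constructor <;> linarith
  have hterm : ∀ l ∈ Finset.range (L + 1), |(2 * (l : ℝ) + 1) / (4 * Real.pi) * κ l *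
      legendre l (dotS x₁ y) - (2 * l + 1) / (4 * Real.pi) * κ l * legendre l (dotS x₂ y)| ≤
      (2 * l + 1) / 12 * M * (2 * l * geoDist x₁ x₂) := by
    intro l hl
    rw [← mul_sub, abs_mul, abs_mul, abs_of_nonneg (by positivity : 0 ≤ (2 * (l : ℝ) + 1) /
      (4 * Real.pi)), ← cos_geoDist, ← cos_geoDist]
    refine mul_le_mul (mul_le_mul ?_ (hκ l (Nat.lt_succ_iff.1 (Finset.mem_range.1 hl)))
      (abs_nonneg _) (by positivity)) ((abs_legendre_cos_sub_le l _ _).trans ?_) (abs_nonneg _)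
      (by positivity)
    · exact div_le_div_of_nonneg_left (by positivity) (by norm_num)
        (by linarith [Real.pi_gt_three])
    · gcongr
  simp only [smoothingKernel, ← Finset.sum_sub_distrib]
  refine (Finset.abs_sum_le_sum_abs _ _).trans ((Finset.sum_le_sum hterm).trans ?_)
  -- The term `l = 0` vanishes and each of the other `L` terms is at most `L²`; the 12 comes from
  -- `4π ≥ 12`.
  have hsum : ∑ l ∈ Finset.range (L + 1), (2 * (l : ℝ) + 1) / 12 * (2 * l) ≤ (L : ℝ) ^ 3 := by
    rw [Finset.sum_range_succ']
    simp only [Nat.cast_zero, mul_zero, add_zero]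
    refine (Finset.sum_le_card_nsmul _ _ ((L : ℝ) ^ 2) fun l hl ↦ ?_).trans ?_
    · have h1 : ((l + 1 : ℕ) : ℝ) ≤ L := by exact_mod_cast Finset.mem_range.1 hl
      have h2 : (1 : ℝ) ≤ ((l + 1 : ℕ) : ℝ) := by push_cast; linarith [(l.cast_nonneg : (0 : ℝ) ≤ l)]
      nlinarith
    · rw [Finset.card_range, nsmul_eq_mul]
      exact le_of_eq (by ring)
  calc _ = (∑ l ∈ Finset.range (L + 1), (2 * (l : ℝ) + 1) / 12 * (2 * l)) *
        (M * geoDist x₁ x₂) := by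
        rw [Finset.sum_mul]
        exact Finset.sum_congr rfl fun l _ ↦ by ring
    _ ≤ (L : ℝ) ^ 3 * (M * geoDist x₁ x₂) :=
        mul_le_mul_of_nonneg_right hsum (mul_nonneg hM (geoDist_nonneg _ _))
    _ = _ := by ring

lemma abs_smoothing_sub_le {L : ℕ} {κ : ℕ → ℝ} {M : ℝ} (hκ : ∀ l ≤ L, |κ l| ≤ M) {h : S2 → ℝ}
    (hh : Integrable h surface) (x₁ x₂ : S2) :
    |smoothing L κ h x₁ - smoothing L κ h x₂| ≤
      M * L ^ 3 * geoDist x₁ x₂ * ∫ y, |h y| ∂surface := by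
  rw [smoothing, smoothing, ← integral_sub (integrable_smoothingKernel_mul hh x₁)
    (integrable_smoothingKernel_mul hh x₂), ← integral_const_mul]
  refine norm_integral_le_of_norm_le (G := ℝ) (hh.abs.const_mul _) (Eventually.of_forall fun y ↦ ?_)
  rw [← sub_mul, norm_mul]
  exact mul_le_mul_of_nonneg_right (abs_smoothingKernel_sub_le hκ x₁ x₂ y) (abs_nonneg _)

lemma abs_smoothing_le {L : ℕ} {κ : ℕ → ℝ} {C : ℝ}
    (hC : ∀ x y : S2, |smoothingKernel L κ (dotS x y)| ≤ C) {h : S2 → ℝ}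
    (hh : Integrable h surface) (x : S2) :
    |smoothing L κ h x| ≤ C * ∫ y, |h y| ∂surface := by
  rw [smoothing, ← integral_const_mul]
  refine norm_integral_le_of_norm_le (G := ℝ) (hh.abs.const_mul _) (Eventually.of_forall fun y ↦ ?_)
  rw [norm_mul]
  exact mul_le_mul_of_nonneg_right (hC x y) (abs_nonneg _)

/-! ### Random elements of `C(S²)`: measurability, compactness, tightness -/

open TopologicalSpace in
-- The distance to a fixed function is a supremum over a countable dense set, hence measurable; by
-- separability every open set is a countable union of balls.
lemma measurable_continuousMap_of_eval_dense {Ω : Type*} [MeasurableSpace Ω] {F : Ω → C(S2, ℝ)}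
    (hF : ∀ n, Measurable fun ω ↦ F ω (denseSeq S2 n)) : Measurable F := by
  have hdist : ∀ c : C(S2, ℝ), Measurable fun ω ↦ dist (F ω) c := by
    intro c
    refine measurable_of_Iic fun s ↦ ?_
    rcases lt_or_ge s 0 with hs | hs
    · convert MeasurableSet.empty
      ext ω
      simpa using hs.trans_le dist_nonneg
    · have : (fun ω ↦ dist (F ω) c) ⁻¹' Iic s =
          ⋂ n, {ω | dist (F ω (denseSeq S2 n)) (c (denseSeq S2 n)) ≤ s} := by
        ext ω
        simp only [mem_preimage, mem_Iic, mem_iInter, mem_ofPred_eq]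
        rw [ContinuousMap.dist_le hs]
        refine ⟨fun h n ↦ h _, fun h x ↦ ?_⟩
        have hcl : IsClosed {x : S2 | dist (F ω x) (c x) ≤ s} :=
          isClosed_le (by fun_prop) continuous_const
        have : closure (range (denseSeq S2)) ⊆ {x : S2 | dist (F ω x) (c x) ≤ s} :=
          hcl.closure_subset_iff.2 (by rintro _ ⟨n, rfl⟩; exact h n)
        exact this (by rw [(denseRange_denseSeq S2).closure_range]; trivial)
      rw [this]
      exact MeasurableSet.iInter fun n ↦ measurableSet_le ((hF n).dist measurable_const)
        measurable_const
  refine measurable_of_isOpen fun U hU ↦ ?_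
  have hU' : U = ⋃ n : ℕ, ⋃ m : ℕ, ⋃ (_ : Metric.ball (denseSeq C(S2, ℝ) n)
      (1 / ((m : ℝ) + 1)) ⊆ U), Metric.ball (denseSeq C(S2, ℝ) n) (1 / ((m : ℝ) + 1)) := by
    ext x
    simp only [mem_iUnion, exists_prop]
    refine ⟨fun hx ↦ ?_, fun ⟨n, m, h, hx⟩ ↦ h hx⟩
    obtain ⟨ε, hε, hεU⟩ := Metric.isOpen_iff.1 hU x hx
    obtain ⟨m, hm⟩ := exists_nat_one_div_lt (half_pos hε)
    have hm0 : (0 : ℝ) < 1 / ((m : ℝ) + 1) := by positivity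
    obtain ⟨n, hn⟩ := (denseRange_denseSeq C(S2, ℝ)).exists_dist_lt x hm0
    refine ⟨n, m, fun y hy ↦ hεU ?_, hn⟩
    rw [Metric.mem_ball] at hy ⊢
    have := dist_triangle y (denseSeq C(S2, ℝ) n) x
    rw [dist_comm x] at hn
    linarith
  rw [hU']
  simp only [preimage_iUnion]
  refine MeasurableSet.iUnion fun n ↦ MeasurableSet.iUnion fun m ↦ MeasurableSet.iUnion fun _ ↦ ?_
  exact measurableSet_lt (hdist _) measurable_const

open TopologicalSpace in
lemma isRandomContinuous_of_aemeasurable {Ω : Type*} [MeasurableSpace Ω] {X : S2 → Ω → ℝ}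
    {P : Measure Ω} (hc : ∀ᵐ ω ∂P, Continuous fun x ↦ X x ω) (hm : ∀ x, AEMeasurable (X x) P) :
    IsRandomContinuous X P := by
  classical
  refine ⟨hc, ?_⟩
  have hae : ∀ᵐ ω ∂P, (Continuous fun x ↦ X x ω) ∧
      ∀ n, X (denseSeq S2 n) ω = (hm (denseSeq S2 n)).mk _ ω :=
    hc.and (ae_all_iff.2 fun n ↦ (hm _).ae_eq_mk)
  -- Off this measurable null set the path is continuous and agrees with measurable versions at the
  -- dense points; on it the path is replaced by 0.
  set N := toMeasurable P {ω | ¬ ((Continuous fun x ↦ X x ω) ∧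
      ∀ n, X (denseSeq S2 n) ω = (hm (denseSeq S2 n)).mk _ ω)} with hN
  have hN0 : P N = 0 := by rw [hN, measure_toMeasurable]; exact hae
  have hNm : MeasurableSet N := measurableSet_toMeasurable _ _
  have hgood : ∀ ω, ω ∉ N → (Continuous fun x ↦ X x ω) ∧
      ∀ n, X (denseSeq S2 n) ω = (hm (denseSeq S2 n)).mk _ ω := by
    intro ω hω
    by_contra h
    exact hω (subset_toMeasurable _ _ h)
  refine ⟨fun ω ↦ if ω ∈ N then 0 else toPath fun x ↦ X x ω, ?_, ?_⟩
  · refine measurable_continuousMap_of_eval_dense fun n ↦ ?_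
    have : (fun ω ↦ (if ω ∈ N then (0 : C(S2, ℝ)) else toPath fun x ↦ X x ω) (denseSeq S2 n)) =
        fun ω ↦ if ω ∈ N then 0 else (hm (denseSeq S2 n)).mk _ ω := by
      funext ω
      split_ifs with h
      · rfl
      · rw [toPath, dif_pos (hgood ω h).1]
        exact (hgood ω h).2 n
    rw [this]
    exact Measurable.ite hNm measurable_const (hm _).measurable_mk
  · have : ∀ᵐ ω ∂P, ω ∉ N := measure_eq_zero_iff_ae_notMem.1 hN0
    filter_upwards [this] with ω hω
    rw [if_neg hω]

/-- The functions on the sphere with given bounds on their values and on their Lipschitz constant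
form a compact set. -/
lemma isCompact_bounded_lipschitz (c d : ℝ) :
    IsCompact {F : C(S2, ℝ) | (∀ x, |F x| ≤ c) ∧ ∀ x y, |F x - F y| ≤ d * geoDist x y} := by
  have hgeo : ∀ x₀ : S2, Continuous (geoDist x₀) := fun x₀ ↦
    Real.continuous_arccos.comp (continuous_dotS continuous_const continuous_id)
  have hself : ∀ x, geoDist x x = 0 := fun x ↦ by rw [geoDist, dotS_self, Real.arccos_one]
  have hequi : ∀ (x₀ : S2), ∀ ε > 0, ∀ᶠ x in 𝓝 x₀, d * geoDist x₀ x < ε := by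
    intro x₀ ε hε
    have h1 : Continuous fun x ↦ d * geoDist x₀ x :=
      continuous_const.mul (hgeo x₀)
    have h2 := h1.tendsto x₀
    rw [hself, mul_zero] at h2
    exact h2.eventually (gt_mem_nhds hε)
  refine ArzelaAscoli.isCompact_of_equicontinuous _ ?_ ?_
  -- Pointwise compactness: the Lipschitz condition already forces continuity, so the image is a
  -- closed subset of a product of intervals.
  · have himage : ContinuousMap.toFun '' {F : C(S2, ℝ) | (∀ x, |F x| ≤ c) ∧
        ∀ x y, |F x - F y| ≤ d * geoDist x y} =
        Set.pi univ (fun _ : S2 ↦ Icc (-c) c) ∩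
          ⋂ x : S2, ⋂ y : S2, {F | |F x - F y| ≤ d * geoDist x y} := by
      ext F
      simp only [mem_image, mem_ofPred_eq, mem_inter_iff, Set.mem_pi, mem_univ, true_implies,
        mem_iInter, mem_Icc, ← abs_le]
      constructor
      · rintro ⟨G, h, rfl⟩
        exact h
      · intro h
        refine ⟨⟨F, ?_⟩, h, rfl⟩
        rw [continuous_iff_continuousAt]
        intro x₀
        rw [Metric.continuousAt_iff']
        intro ε hε
        filter_upwards [hequi x₀ ε hε] with x hx
        rw [dist_comm, Real.dist_eq]
        exact (h.2 x₀ x).trans_lt hx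
    rw [himage]
    refine (isCompact_univ_pi fun _ ↦ isCompact_Icc).inter_right ?_
    exact isClosed_iInter fun x ↦ isClosed_iInter fun y ↦
      isClosed_le (((continuous_apply x).sub (continuous_apply y)).abs) continuous_const
  · intro x₀
    rw [Metric.equicontinuousAt_iff_right]
    intro ε hε
    filter_upwards [hequi x₀ ε hε] with x hx F
    rw [Real.dist_eq]
    exact (F.2.2 x₀ x).trans_lt hx

section

variable {Ω : Type*} [MeasurableSpace Ω] {P : Measure Ω} {L : ℕ} {κ : ℕ → ℝ} {X Z : S2 → Ω → ℝ}

lemma ae_continuous_of_smoothing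
    (h : ∀ᵐ ω ∂P, Integrable (fun y ↦ Z y ω) surface ∧
      ∀ x, X x ω = smoothing L κ (fun y ↦ Z y ω) x) :
    ∀ᵐ ω ∂P, Continuous fun x ↦ X x ω := by
  filter_upwards [h] with ω hω
  have : (fun x ↦ X x ω) = smoothing L κ (fun y ↦ Z y ω) := funext hω.2
  rw [this]
  exact continuous_smoothing hω.1

lemma ofReal_integral_abs {h : S2 → ℝ} (hh : Integrable h surface) :
    ENNReal.ofReal (∫ y, |h y| ∂surface) = ∫⁻ y, ‖h y‖ₑ ∂surface := by
  rw [ofReal_integral_eq_lintegral_ofReal hh.abs (Eventually.of_forall fun y ↦ abs_nonneg _)]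
  simp [Real.enorm_eq_ofReal_abs]

lemma lintegral_modulus_smoothing_le {M : ℝ} (hκ : ∀ l ≤ L, |κ l| ≤ M)
    (h : ∀ᵐ ω ∂P, Integrable (fun y ↦ Z y ω) surface ∧
      ∀ x, X x ω = smoothing L κ (fun y ↦ Z y ω) x) {A : ℝ}
    (hA : ∫⁻ ω, ∫⁻ y, ‖Z y ω‖ₑ ∂surface ∂P ≤ ENNReal.ofReal A) {δ : ℝ} (hδ : 0 < δ) :
    ∫⁻ ω, modulus δ (fun x ↦ X x ω) ∂P ≤ ENNReal.ofReal (M * A * (L : ℝ) ^ 3 * δ) := by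
  have hM : 0 ≤ M := (abs_nonneg _).trans (hκ 0 (Nat.zero_le L))
  have hle : ∀ᵐ ω ∂P, modulus δ (fun x ↦ X x ω) ≤
      ENNReal.ofReal (M * L ^ 3 * δ) * ∫⁻ y, ‖Z y ω‖ₑ ∂surface := by
    filter_upwards [h] with ω hω
    refine iSup_le fun x ↦ iSup_le fun y ↦ iSup_le fun hxy ↦ ?_
    simp only [hω.2]
    rw [← ofReal_integral_abs hω.1, ← ENNReal.ofReal_mul (by positivity)]
    refine ENNReal.ofReal_le_ofReal ((abs_smoothing_sub_le hκ hω.1 x y).trans ?_)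
    have : 0 ≤ ∫ y, |Z y ω| ∂surface := integral_nonneg fun y ↦ abs_nonneg _
    gcongr
  refine (lintegral_mono_ae hle).trans ?_
  rw [lintegral_const_mul' _ _ ENNReal.ofReal_ne_top]
  refine (mul_le_mul_right hA _).trans ?_
  rw [← ENNReal.ofReal_mul (by positivity)]
  exact ENNReal.ofReal_le_ofReal (le_of_eq (by ring))

end

/-- A bound `a` on `∫ |Z|` bounds both the values and the Lipschitz constant of the path, which then
lies in a compact set; Markov's inequality controls the exceptional event. -/
lemma isTightMeasureSet_smoothing {Ω : ℕ → Type*} [∀ j, MeasurableSpace (Ω j)]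
    {P : ∀ j, Measure (Ω j)} {L : ℕ} {κ : ℕ → ℝ} {X Z : ∀ j, S2 → Ω j → ℝ}
    (hX : ∀ j, IsRandomContinuous (X j) (P j))
    (h : ∀ j, ∀ᵐ ω ∂(P j), Integrable (fun y ↦ Z j y ω) surface ∧
      ∀ x, X j x ω = smoothing L κ (fun y ↦ Z j y ω) x)
    (hm : ∀ j, AEMeasurable (fun ω ↦ ∫⁻ y, ‖Z j y ω‖ₑ ∂surface) (P j)) {A : ℝ}
    (hA : ∀ j, ∫⁻ ω, ∫⁻ y, ‖Z j y ω‖ₑ ∂surface ∂(P j) ≤ ENNReal.ofReal A) :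
    IsTightMeasureSet (range fun j ↦ pathLaw (X j) (P j)) := by
  rw [isTightMeasureSet_iff_exists_isCompact_measure_compl_le]
  intro ε hε
  obtain ⟨C, hC0, hC⟩ := exists_smoothingKernel_bound L κ
  obtain ⟨M, hM⟩ : ∃ M, ∀ l ≤ L, |κ l| ≤ M :=
    ⟨∑ l ∈ Finset.range (L + 1), |κ l|, fun l hl ↦ Finset.single_le_sum (f := fun l ↦ |κ l|)
      (fun i _ ↦ abs_nonneg _) (Finset.mem_range.2 (Nat.lt_succ_of_le hl))⟩
  have hM0 : 0 ≤ M := (abs_nonneg _).trans (hM 0 (Nat.zero_le L))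
  -- The minimum makes the tolerance finite. With `a = (|A| + 1) / e`, Markov's bound `A / a` is at
  -- most `e`.
  set e := (min ε 1).toReal with he
  have hmin : min ε 1 ≠ ∞ := (min_lt_of_right_lt ENNReal.one_lt_top).ne
  have he0 : 0 < e := ENNReal.toReal_pos (lt_min hε one_pos).ne' hmin
  set a := (|A| + 1) / e with ha
  have ha0 : 0 < a := by positivity
  refine ⟨_, isCompact_bounded_lipschitz (C * a) (M * L ^ 3 * a), ?_⟩
  rintro _ ⟨j, rfl⟩
  have hclosed := (isCompact_bounded_lipschitz (C * a) (M * L ^ 3 * a)).isClosed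
  simp only [pathLaw]
  rw [Measure.map_apply_of_aemeasurable (hX j).aemeasurable_path
    hclosed.measurableSet.compl]
  have hsub : P j ((fun ω ↦ toPath fun x ↦ X j x ω) ⁻¹' {F : C(S2, ℝ) | (∀ x, |F x| ≤ C * a) ∧
      ∀ x y, |F x - F y| ≤ M * L ^ 3 * a * geoDist x y}ᶜ) ≤
      P j {ω | ENNReal.ofReal a ≤ ∫⁻ y, ‖Z j y ω‖ₑ ∂surface} := by
    refine measure_mono_ae ?_
    filter_upwards [h j, (hX j).continuous_paths] with ω hω hcont hmem
    by_contra hlt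
    have hlt' : ∫ y, |Z j y ω| ∂surface < a := by
      have h2 : ¬ ENNReal.ofReal a ≤ ∫⁻ y, ‖Z j y ω‖ₑ ∂surface := hlt
      rw [← ofReal_integral_abs hω.1, not_le, ENNReal.ofReal_lt_ofReal_iff ha0] at h2
      exact h2
    refine hmem ?_
    have hval : ∀ x, (toPath fun x ↦ X j x ω) x = smoothing L κ (fun y ↦ Z j y ω) x := by
      intro x
      rw [toPath, dif_pos hcont]
      exact hω.2 x
    refine ⟨fun x ↦ ?_, fun x y ↦ ?_⟩
    · rw [hval]
      exact (abs_smoothing_le hC hω.1 x).trans (mul_le_mul_of_nonneg_left hlt'.le hC0)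
    · rw [hval, hval]
      refine (abs_smoothing_sub_le hM hω.1 x y).trans ?_
      have := geoDist_nonneg x y
      calc _ ≤ M * L ^ 3 * geoDist x y * a := by gcongr
        _ = _ := by ring
  refine hsub.trans ((meas_ge_le_lintegral_div (hm j) (by simpa using ha0)
    ENNReal.ofReal_ne_top).trans ?_)
  refine (ENNReal.div_le_div_right (hA j) _).trans ?_
  rw [← ENNReal.ofReal_div_of_pos ha0]
  refine le_trans ?_ (min_le_left ε 1)
  rw [← ENNReal.ofReal_toReal hmin, ← he]
  apply ENNReal.ofReal_le_ofReal
  rw [ha, div_div_eq_mul_div, div_le_iff₀ (by positivity), mul_comm]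
  exact mul_le_mul_of_nonneg_left ((le_abs_self A).trans (by linarith)) he0.le

/-! ### Smoothing of second-order random fields -/

lemma measurable_dotS {α : Type*} [MeasurableSpace α] {f g : α → S2} (hf : Measurable f)
    (hg : Measurable g) : Measurable fun a ↦ dotS (f a) (g a) :=
  (measurable_subtype_coe.comp hf).inner (measurable_subtype_coe.comp hg)

/-- Cauchy–Schwarz on a space of mass `4π`, from the nonnegativity of `∫ (4π h - ∫ h)²`. -/
lemma sq_integral_le {h : S2 → ℝ} (hh : MemLp h 2 surface) :
    (∫ y, h y ∂surface) ^ 2 ≤ 4 * Real.pi * ∫ y, h y ^ 2 ∂surface := by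
  have hi : Integrable h surface := hh.integrable (by norm_num)
  set I := ∫ y, h y ∂surface with hI
  have h0 : 0 ≤ ∫ y, (4 * Real.pi * h y - I) ^ 2 ∂surface := integral_nonneg fun y ↦ sq_nonneg _
  have he : ∀ y, (4 * Real.pi * h y - I) ^ 2 =
      (4 * Real.pi) ^ 2 * h y ^ 2 - 2 * (4 * Real.pi) * I * h y + I ^ 2 := fun y ↦ by ring
  have i1 : Integrable (fun y ↦ (4 * Real.pi) ^ 2 * h y ^ 2) surface := hh.integrable_sq.const_mul _
  have i2 : Integrable (fun y ↦ 2 * (4 * Real.pi) * I * h y) surface := hi.const_mul _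
  have i12 : Integrable (fun y ↦ (4 * Real.pi) ^ 2 * h y ^ 2 - 2 * (4 * Real.pi) * I * h y)
    surface := i1.sub i2
  simp_rw [he] at h0
  rw [integral_add i12 (integrable_const _), integral_sub i1 i2, integral_const_mul,
    integral_const_mul, ← hI, integral_const, surface_real_univ, smul_eq_mul] at h0
  have hp : 0 < 4 * Real.pi := by positivity
  have : 4 * Real.pi * I ^ 2 ≤ 4 * Real.pi * (4 * Real.pi * ∫ y, h y ^ 2 ∂surface) := by
    linarith
  exact le_of_mul_le_mul_left this hp

section

variable {Ω : Type*} [MeasurableSpace Ω] {P : Measure Ω} {U : S2 → Ω → ℝ}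

lemma ae_memLp_two_of_prod [SFinite P] (hU : Measurable (Function.uncurry U))
    (hU2 : MemLp (Function.uncurry U) 2 (surface.prod P)) :
    ∀ᵐ ω ∂P, MemLp (fun y ↦ U y ω) 2 surface := by
  filter_upwards [hU2.integrable_sq.prod_left_ae] with ω hω
  have hm : Measurable fun y ↦ U y ω := hU.comp measurable_prodMk_right
  exact (memLp_two_iff_integrable_sq hm.aestronglyMeasurable).2 hω

lemma measurable_smoothing (hU : Measurable (Function.uncurry U)) (L : ℕ) (μ : ℕ → ℝ) :
    Measurable (Function.uncurry fun x ω ↦ smoothing L μ (fun y ↦ U y ω) x) := by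
  have : Measurable fun p : (S2 × Ω) × S2 ↦
      smoothingKernel L μ (dotS p.1.1 p.2) * U p.2 p.1.2 := by
    refine Measurable.mul ?_ (hU.comp (measurable_snd.prodMk (measurable_snd.comp measurable_fst)))
    exact (continuous_smoothingKernel L μ).measurable.comp
      (measurable_dotS (measurable_fst.comp measurable_fst) measurable_snd)
  exact (this.stronglyMeasurable.integral_prod_right' (ν := surface)).measurable

lemma smoothing_sq_le {L : ℕ} {μ : ℕ → ℝ} {C : ℝ}
    (hC : ∀ x y : S2, |smoothingKernel L μ (dotS x y)| ≤ C) {h : S2 → ℝ} (hh : MemLp h 2 surface)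
    (x : S2) : smoothing L μ h x ^ 2 ≤ C ^ 2 * (4 * Real.pi * ∫ y, h y ^ 2 ∂surface) := by
  have h1 := abs_smoothing_le hC (hh.integrable (by norm_num)) x
  have h2 := sq_integral_le hh.abs
  simp only [Pi.abs_apply, sq_abs] at h2
  calc smoothing L μ h x ^ 2 = |smoothing L μ h x| ^ 2 := (sq_abs _).symm
    _ ≤ (C * ∫ y, |h y| ∂surface) ^ 2 := pow_le_pow_left₀ (abs_nonneg _) h1 2
    _ = C ^ 2 * (∫ y, |h y| ∂surface) ^ 2 := by ring
    _ ≤ _ := mul_le_mul_of_nonneg_left h2 (sq_nonneg _)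

variable [IsProbabilityMeasure P]

lemma memLp_smoothing (hU : Measurable (Function.uncurry U))
    (hU2 : MemLp (Function.uncurry U) 2 (surface.prod P)) (L : ℕ) (μ : ℕ → ℝ) (x : S2) :
    MemLp (fun ω ↦ smoothing L μ (fun y ↦ U y ω) x) 2 P := by
  obtain ⟨C, hC0, hC⟩ := exists_smoothingKernel_bound L μ
  have hm : Measurable fun ω ↦ smoothing L μ (fun y ↦ U y ω) x :=
    (measurable_smoothing hU L μ).of_uncurry_left (x := x)
  rw [memLp_two_iff_integrable_sq hm.aestronglyMeasurable]
  have hint : Integrable (fun ω ↦ C ^ 2 * (4 * Real.pi * ∫ y, U y ω ^ 2 ∂surface)) P :=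
    (hU2.integrable_sq.integral_prod_right.const_mul _).const_mul _
  refine hint.mono' (hm.pow_const 2).aestronglyMeasurable ?_
  filter_upwards [ae_memLp_two_of_prod hU hU2] with ω hω
  rw [Real.norm_eq_abs, abs_of_nonneg (sq_nonneg _)]
  exact smoothing_sq_le hC hω x

lemma memLp_uncurry_smoothing (hU : Measurable (Function.uncurry U))
    (hU2 : MemLp (Function.uncurry U) 2 (surface.prod P)) (L : ℕ) (μ : ℕ → ℝ) :
    MemLp (Function.uncurry fun x ω ↦ smoothing L μ (fun y ↦ U y ω) x) 2 (surface.prod P) := by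
  obtain ⟨C, hC0, hC⟩ := exists_smoothingKernel_bound L μ
  have hm := measurable_smoothing hU L μ
  rw [memLp_two_iff_integrable_sq hm.aestronglyMeasurable]
  have hint : Integrable (fun ω ↦ C ^ 2 * (4 * Real.pi * ∫ y, U y ω ^ 2 ∂surface)) P :=
    (hU2.integrable_sq.integral_prod_right.const_mul _).const_mul _
  refine (hint.comp_snd surface).mono' (hm.pow_const 2).aestronglyMeasurable ?_
  have := (Measure.quasiMeasurePreserving_snd (μ := surface) (ν := P)).ae
    (ae_memLp_two_of_prod hU hU2)
  filter_upwards [this] with p hp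
  rw [Real.norm_eq_abs, abs_of_nonneg (sq_nonneg _)]
  exact smoothing_sq_le hC hp p.1

/-- Smoothing commutes with taking the mixed moment with a fixed square-integrable variable. -/
lemma smoothing_integral_mul (hU2 : MemLp (Function.uncurry U) 2 (surface.prod P)) (L : ℕ)
    (μ : ℕ → ℝ) (x : S2) {Y : Ω → ℝ} (hY : MemLp Y 2 P) :
    smoothing L μ (fun y ↦ ∫ ω, U y ω * Y ω ∂P) x =
      ∫ ω, smoothing L μ (fun y ↦ U y ω) x * Y ω ∂P := by
  simp only [smoothing, ← integral_const_mul, ← integral_mul_const]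
  rw [integral_integral_swap]
  · simp only [mul_assoc]
  · obtain ⟨C, _, hC⟩ := exists_smoothingKernel_bound L μ
    have h1 : Integrable (fun p : S2 × Ω ↦ Function.uncurry U p * Y p.2) (surface.prod P) :=
      hU2.integrable_mul (hY.comp_snd surface)
    have h2 : Measurable fun p : S2 × Ω ↦ smoothingKernel L μ (dotS x p.1) :=
       (continuous_smoothingKernel L μ).measurable.comp
        (measurable_dotS measurable_const measurable_fst)
    exact h1.bdd_mul (c := C) h2.aestronglyMeasurable (Eventually.of_forall fun p ↦ hC x p.1)

lemma memLp_uncurry_of_integral_sq_le (hU : Measurable (Function.uncurry U)) {V : ℝ}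
    (h2 : ∀ y, MemLp (U y) 2 P) (hV : ∀ y, ∫ ω, U y ω ^ 2 ∂P ≤ V) :
    MemLp (Function.uncurry U) 2 (surface.prod P) := by
  rw [memLp_two_iff_integrable_sq hU.aestronglyMeasurable,
    integrable_prod_iff (hU.pow_const 2).aestronglyMeasurable]
  refine ⟨Eventually.of_forall fun y ↦ (h2 y).integrable_sq, ?_⟩
  refine (integrable_const V).mono' ?_ (Eventually.of_forall fun y ↦ ?_)
  · exact (hU.pow_const 2).norm.stronglyMeasurable.integral_prod_right'.aestronglyMeasurable
  · rw [Real.norm_eq_abs, abs_of_nonneg (integral_nonneg fun ω ↦ norm_nonneg _)]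
    simpa [Function.uncurry] using hV y

end

/-! ### Gaussianity of smoothed Gaussian fields -/

lemma norm_sq_lp {Ω : Type*} [MeasurableSpace Ω] {P : Measure Ω} (u : Lp ℝ 2 P) :
    ‖u‖ ^ 2 = ∫ ω, u ω ^ 2 ∂P := by
  rw [← real_inner_self_eq_norm_sq, L2.inner_def]
  exact integral_congr_ae (Eventually.of_forall fun ω ↦ by simp [sq])

section

variable {Ω : Type*} [MeasurableSpace Ω] {P : Measure Ω} [IsProbabilityMeasure P]

lemma integral_abs_le_norm_lp (u : Lp ℝ 2 P) : ∫ ω, |u ω| ∂P ≤ ‖u‖ := by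
  have h1 : Integrable u P := (Lp.memLp u).integrable (by norm_num)
  have h2 : ∫ ω, |u ω| ∂P = (eLpNorm u 1 P).toReal := by
    rw [eLpNorm_one_eq_lintegral_enorm, ← integral_norm_eq_lintegral_enorm h1.aestronglyMeasurable]
    rfl
  rw [h2, Lp.norm_def]
  exact ENNReal.toReal_mono (Lp.eLpNorm_ne_top u)
    (eLpNorm_le_eLpNorm_of_exponent_le (by norm_num) h1.aestronglyMeasurable)

lemma norm_exp_mul_I_sub_le (a b : ℝ) :
    ‖Complex.exp (a * Complex.I) - Complex.exp (b * Complex.I)‖ ≤ |a - b| := by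
  have h : Complex.exp (a * Complex.I) - Complex.exp (b * Complex.I) =
      Complex.exp (b * Complex.I) * (Complex.exp (Complex.I * ((a - b : ℝ) : ℂ)) - 1) := by
    rw [mul_sub, mul_one, ← Complex.exp_add]
    congr 2
    push_cast
    ring
  rw [h, norm_mul, Complex.norm_exp_ofReal_mul_I, one_mul]
  exact Real.norm_exp_I_mul_ofReal_sub_one_le

lemma integrable_exp_mul_I {u : Ω → ℝ} (hu : AEStronglyMeasurable u P) :
    Integrable (fun ω ↦ Complex.exp ((u ω : ℂ) * Complex.I)) P := by
  refine (integrable_const (1 : ℝ)).mono' ?_ (Eventually.of_forall fun ω ↦ ?_)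
  · exact (Complex.continuous_exp.comp_aestronglyMeasurable
      ((Complex.continuous_ofReal.comp_aestronglyMeasurable hu).mul_const _))
  · rw [Complex.norm_exp_ofReal_mul_I]

/-- Used to pass the Gaussian form of the characteristic function to `L²` limits. -/
lemma continuous_charFun_lp (t : ℝ) :
    Continuous fun u : Lp ℝ 2 P ↦ ∫ ω, Complex.exp (((t * u ω : ℝ) : ℂ) * Complex.I) ∂P := by
  refine (LipschitzWith.of_dist_le_mul (K := Real.nnabs t) fun u v ↦ ?_).continuous
  have hu : AEStronglyMeasurable (fun ω ↦ t * u ω) P := (Lp.aestronglyMeasurable u).const_mul t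
  have hv : AEStronglyMeasurable (fun ω ↦ t * v ω) P := (Lp.aestronglyMeasurable v).const_mul t
  rw [dist_eq_norm, ← integral_sub (integrable_exp_mul_I hu) (integrable_exp_mul_I hv),
    Real.coe_nnabs, dist_eq_norm]
  have hi : Integrable (u - v : Lp ℝ 2 P) P := (Lp.memLp (u - v)).integrable (by norm_num)
  have h1 : ‖∫ ω, (Complex.exp (((t * u ω : ℝ) : ℂ) * Complex.I) -
      Complex.exp (((t * v ω : ℝ) : ℂ) * Complex.I)) ∂P‖ ≤ ∫ ω, |t| * |(u - v : Lp ℝ 2 P) ω| ∂P := by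
    refine norm_integral_le_of_norm_le (hi.abs.const_mul _) ?_
    filter_upwards [Lp.coeFn_sub u v] with ω hω
    refine (norm_exp_mul_I_sub_le _ _).trans (le_of_eq ?_)
    rw [hω, ← mul_sub, abs_mul, Pi.sub_apply]
  refine h1.trans ?_
  rw [integral_const_mul]
  exact mul_le_mul_of_nonneg_left (integral_abs_le_norm_lp _) (abs_nonneg _)

variable {T : S2 → Ω → ℝ}

lemma charFun_span_of_gaussian (hT : IsGaussianProcess T P) (h0 : ∀ y, ∫ ω, T y ω ∂P = 0)
    (h2 : ∀ y, MemLp (T y) 2 P) {u : Lp ℝ 2 P}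
    (hu : u ∈ Submodule.span ℝ (range fun y ↦ (h2 y).toLp (T y))) (t : ℝ) :
    ∫ ω, Complex.exp (((t * u ω : ℝ) : ℂ) * Complex.I) ∂P =
      Complex.exp (((-(‖u‖ ^ 2 * t ^ 2 / 2) : ℝ) : ℂ)) := by
  obtain ⟨c, rfl⟩ := Finsupp.mem_span_range_iff_exists_finsupp.1 hu
  have hae : ((c.sum fun y a ↦ a • (h2 y).toLp (T y) : Lp ℝ 2 P) : Ω → ℝ) =ᵐ[P]
      fun ω ↦ ∑ i : c.support, c i * T i ω := by
    have h1 : ((c.sum fun y a ↦ a • (h2 y).toLp (T y) : Lp ℝ 2 P)) =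
        ∑ i : c.support, c i • (h2 i).toLp (T i) := by
      rw [Finsupp.sum, ← Finset.sum_coe_sort]
    rw [h1]
    refine (Lp.coeFn_finsetSum _ _).trans ?_
    have h3 : ∀ᵐ ω ∂P, ∀ i : c.support, (c i • (h2 i).toLp (T i) : Lp ℝ 2 P) ω = c i * T i ω := by
      refine ae_all_iff.2 fun i ↦ ?_
      filter_upwards [Lp.coeFn_smul (c i) ((h2 i).toLp (T i)), (h2 i).coeFn_toLp] with ω e1 e2
      rw [e1, Pi.smul_apply, e2, smul_eq_mul]
    filter_upwards [h3] with ω hω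
    rw [Finset.sum_apply]
    exact Finset.sum_congr rfl fun i _ ↦ hω i
  set u := (c.sum fun y a ↦ a • (h2 y).toLp (T y) : Lp ℝ 2 P)
  have hG0 : HasGaussianLaw (fun ω ↦ ∑ i : c.support, c i * T i ω) P := by
    have := (hT.hasGaussianLaw c.support).map_fun
      (∑ i : c.support, c i • ContinuousLinearMap.proj (R := ℝ) (φ := fun _ : c.support ↦ ℝ) i)
    refine this.congr (Eventually.of_forall fun ω ↦ ?_)
    simp only [sum_apply, smul_apply,
      ContinuousLinearMap.proj_apply, smul_eq_mul, Finset.restrict]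
  have hG : HasGaussianLaw u P := hG0.congr hae.symm
  have hmean : ∫ ω, u ω ∂P = 0 := by
    rw [integral_congr_ae hae, integral_finsetSum (f := fun (i : c.support) ω ↦ c i * T i ω) _
      fun i _ ↦ ((h2 i).integrable (by norm_num)).const_mul _]
    exact Finset.sum_eq_zero fun i _ ↦ by rw [integral_const_mul, h0, mul_zero]
  have hvar : Var[u; P] = ‖u‖ ^ 2 := by
    rw [variance_of_integral_eq_zero (Lp.aestronglyMeasurable u).aemeasurable hmean, norm_sq_lp]
  have hmap := hG.map_eq_gaussianReal
  rw [hmean, hvar] at hmap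
  have hchar := charFun_gaussianReal (μ := 0) (v := (‖u‖ ^ 2).toNNReal) t
  rw [← hmap, charFun_apply_real, integral_map (Lp.aestronglyMeasurable u).aemeasurable
    (Continuous.aestronglyMeasurable (by fun_prop))] at hchar
  push_cast
  rw [hchar]
  congr 1
  rw [Real.coe_toNNReal _ (sq_nonneg _)]
  push_cast
  ring

/-- Smoothing a Gaussian field gives centred Gaussian variables. -/
lemma exists_map_smoothing_eq_gaussianReal (hT : IsGaussianProcess T P)
    (hm : Measurable (Function.uncurry T)) (h0 : ∀ y, ∫ ω, T y ω ∂P = 0)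
    (h2 : ∀ y, MemLp (T y) 2 P) (hT2 : MemLp (Function.uncurry T) 2 (surface.prod P))
    (L : ℕ) (μ : ℕ → ℝ) (x : S2) :
    ∃ v, P.map (fun ω ↦ smoothing L μ (fun y ↦ T y ω) x) = gaussianReal 0 v := by
  have hβ := memLp_smoothing hm hT2 L μ x
  set β : Ω → ℝ := fun ω ↦ smoothing L μ (fun y ↦ T y ω) x with hβdef
  set b : Lp ℝ 2 P := hβ.toLp β
  set S : Submodule ℝ (Lp ℝ 2 P) := Submodule.span ℝ (range fun y ↦ (h2 y).toLp (T y))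
  set K := S.topologicalClosure
  have : CompleteSpace K := S.isClosed_topologicalClosure.completeSpace_coe
  -- The residual is orthogonal to every `T y`. Exchanging smoothing and expectation makes it
  -- orthogonal to `b` too, so it is 0 and `b` lies in the closed span. No Riemann sums are needed.
  set r : Lp ℝ 2 P := b - K.starProjection b with hr
  have hrK : r ∈ Kᗮ := K.sub_starProjection_mem_orthogonal b
  have hrT : ∀ y, ∫ ω, T y ω * r ω ∂P = 0 := by
    intro y
    have h1 : inner ℝ ((h2 y).toLp (T y)) r = 0 :=
      (Submodule.mem_orthogonal _ _).1 hrK _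
        (S.le_topologicalClosure (Submodule.subset_span ⟨y, rfl⟩))
    rw [L2.inner_def] at h1
    rw [← h1]
    refine integral_congr_ae ?_
    filter_upwards [(h2 y).coeFn_toLp] with ω hω
    rw [hω]
    simp [mul_comm]
  have hrb : inner ℝ b r = 0 := by
    rw [L2.inner_def]
    have h1 := smoothing_integral_mul hT2 L μ x (Lp.memLp r)
    simp only [hrT] at h1
    have h3 : smoothing L μ (fun _ ↦ 0) x = 0 := by simp [smoothing]
    rw [h3] at h1
    rw [h1]
    refine integral_congr_ae ?_
    filter_upwards [hβ.coeFn_toLp] with ω hω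
    rw [show (b : Ω → ℝ) ω = β ω from hω]
    simp [mul_comm, hβdef]
  have hr0 : r = 0 := by
    rw [← inner_self_eq_zero (𝕜 := ℝ)]
    nth_rw 1 [hr]
    rw [inner_sub_left, hrb, (Submodule.mem_orthogonal _ _).1 hrK _
      (K.starProjection_apply_mem b), sub_zero]
  have hbK : b ∈ K := by
    have : b = K.starProjection b := sub_eq_zero.1 hr0
    rw [this]
    exact K.starProjection_apply_mem b
  refine ⟨(‖b‖ ^ 2).toNNReal, ?_⟩
  have : IsProbabilityMeasure (P.map β) := Measure.isProbabilityMeasure_map hβ.aemeasurable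
  apply Measure.ext_of_charFun
  funext t
  -- The identity holds on the span and defines a closed set, so it holds on the closure.
  have hclosed : IsClosed {u : Lp ℝ 2 P |
      ∫ ω, Complex.exp (((t * u ω : ℝ) : ℂ) * Complex.I) ∂P =
      Complex.exp (((-(‖u‖ ^ 2 * t ^ 2 / 2) : ℝ) : ℂ))} :=
    isClosed_eq (continuous_charFun_lp t) (by fun_prop)
  have hb : b ∈ {u : Lp ℝ 2 P | ∫ ω, Complex.exp (((t * u ω : ℝ) : ℂ) * Complex.I) ∂P =
      Complex.exp (((-(‖u‖ ^ 2 * t ^ 2 / 2) : ℝ) : ℂ))} :=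
    closure_minimal (fun u hu ↦ charFun_span_of_gaussian hT h0 h2 hu t) hclosed hbK
  rw [charFun_gaussianReal, charFun_apply_real, integral_map hβ.aemeasurable
    (Continuous.aestronglyMeasurable (by fun_prop))]
  have e : ∫ ω, Complex.exp (t * β ω * Complex.I) ∂P =
      ∫ ω, Complex.exp (((t * b ω : ℝ) : ℂ) * Complex.I) ∂P := by
    refine integral_congr_ae ?_
    filter_upwards [hβ.coeFn_toLp] with ω hω
    rw [show (b : Ω → ℝ) ω = β ω from hω]
    push_cast
    rfl
  rw [e, hb, Real.coe_toNNReal _ (sq_nonneg _)]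
  congr 1
  push_cast
  ring

end

/-! ### Hermite moments of the normalised needlet field -/

/-- A bound for the second moment of the `q`-th Hermite polynomial of a centred Gaussian variable
whose variance is one or zero. -/
def hermiteBound (q : ℕ) : ℝ :=
  ∫ t, hermiteH q t ^ 2 ∂(gaussianReal 0 1) + hermiteH q 0 ^ 2

lemma continuous_hermiteH (q : ℕ) : Continuous (hermiteH q) := by
  unfold hermiteH
  exact Polynomial.continuous_aeval _

lemma hermiteBound_nonneg (q : ℕ) : 0 ≤ hermiteBound q :=
  add_nonneg (integral_nonneg fun _ ↦ sq_nonneg _) (sq_nonneg _)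

lemma integrable_eval_gaussianReal (p : ℝ[X]) :
    Integrable (fun t ↦ p.eval t) (gaussianReal 0 1) := by
  induction p using Polynomial.induction_on' with
  | add p q hp hq =>
    simp only [eval_add]
    exact hp.add hq
  | monomial n a =>
    simp only [eval_monomial]
    refine Integrable.const_mul ?_ a
    have h := (memLp_id_gaussianReal (μ := 0) (v := 1) (n : NNReal)).integrable_norm_pow'
    refine h.mono' (Continuous.aestronglyMeasurable (by fun_prop)) (Eventually.of_forall fun t ↦ ?_)
    simp

lemma integrable_hermiteH_sq (q : ℕ) : Integrable (fun t ↦ hermiteH q t ^ 2) (gaussianReal 0 1) := by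
  have := integrable_eval_gaussianReal (((hermite q).map (Int.castRingHom ℝ)) ^ 2)
  simpa [hermiteH, aeval_def, eval_map] using this

lemma hermiteH_normalized {Ω : Type*} [MeasurableSpace Ω] {P : Measure Ω} [IsProbabilityMeasure P]
    {β : Ω → ℝ} (hm : Measurable β) {v : NNReal} (hβ : P.map β = gaussianReal 0 v) (q : ℕ) :
    MemLp (fun ω ↦ hermiteH q (β ω / √(variance β P))) 2 P ∧
      ∫ ω, hermiteH q (β ω / √(variance β P)) ^ 2 ∂P ≤ hermiteBound q := by
  have hvar : variance β P = v := by
    rw [← variance_id_map hm.aemeasurable, hβ, variance_id_gaussianReal]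
  have hmeas : Measurable fun ω ↦ hermiteH q (β ω / √(variance β P)) :=
    (continuous_hermiteH q).measurable.comp (hm.div_const _)
  rw [memLp_two_iff_integrable_sq hmeas.aestronglyMeasurable]
  rcases eq_or_ne v 0 with rfl | hv
  -- Division by zero gives 0, so the variable is the constant `hermiteH q 0`; this is the second
  -- summand of `hermiteBound`.
  · simp only [hvar, NNReal.coe_zero, Real.sqrt_zero, div_zero]
    refine ⟨integrable_const _, ?_⟩
    simp only [integral_const, probReal_univ, one_smul]
    exact le_add_of_nonneg_left (integral_nonneg fun _ ↦ sq_nonneg _)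
  · have hmap : P.map (fun ω ↦ β ω / √(variance β P)) = gaussianReal 0 1 := by
      have h1 : P.map (fun ω ↦ β ω / √(variance β P)) =
          (P.map β).map (· / √(variance β P)) := by
        rw [Measure.map_map (by fun_prop) hm]
        rfl
      rw [h1, hβ, gaussianReal_map_div_const, zero_div]
      congr 1
      ext
      simp only [NNReal.coe_div, NNReal.coe_mk, hvar, Real.sq_sqrt v.coe_nonneg, NNReal.coe_one]
      exact div_self (by exact_mod_cast hv)
    have hd : Measurable fun ω ↦ β ω / √(variance β P) := hm.div_const _
    have hc : Continuous fun t ↦ hermiteH q t ^ 2 := (continuous_hermiteH q).pow 2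
    constructor
    · have := integrable_hermiteH_sq q
      rw [← hmap] at this
      exact (integrable_map_measure hc.aestronglyMeasurable hd.aemeasurable).1 this
    · have := integral_map hd.aemeasurable (μ := P) (f := fun t ↦ hermiteH q t ^ 2)
        hc.aestronglyMeasurable
      rw [hmap] at this
      rw [← this]
      exact le_add_of_nonneg_right (sq_nonneg _)

/-- The half-turn about the bisector `x + y` exchanges `x` and `y`; it negates a plane, so its
determinant is `(-1)² = 1`. -/
lemma exists_rotate_eq (x y : S2) (h : (x : E3) + y ≠ 0) :
    ∃ R : E3 ≃ₗᵢ[ℝ] E3, LinearMap.det (R.toLinearEquiv : E3 →ₗ[ℝ] E3) = 1 ∧ rotate R x = y := by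
  refine ⟨(ℝ ∙ ((x : E3) + y)).reflection, ?_, ?_⟩
  · have h1 := (ℝ ∙ ((x : E3) + y)).finrank_add_finrank_orthogonal
    rw [finrank_span_singleton h, finrank_euclideanSpace_fin] at h1
    have h2 : Module.finrank ℝ (ℝ ∙ ((x : E3) + y))ᗮ = 2 := by omega
    have h3 := (ℝ ∙ ((x : E3) + y)).det_reflection
    rw [h2, neg_one_sq] at h3
    exact h3
  · ext1
    have h1 := Submodule.reflection_sub (v := (x : E3)) (w := -(y : E3)) (by simp)
    rw [sub_neg_eq_add, Submodule.reflection_orthogonal_apply] at h1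
    exact neg_injective h1

lemma IsIsotropicGaussian.memLp_two {Ω : Type*} [MeasurableSpace Ω] {P : Measure Ω}
    {T : S2 → Ω → ℝ} (hT : IsIsotropicGaussian T P) (y : S2) : MemLp (T y) 2 P :=
  (hT.gaussian.hasGaussianLaw_eval y).memLp_two

/-- Half-turns carry a base point everywhere except to its antipode. A uniform bound is enough, so
the antipode is included through a maximum. -/
lemma IsIsotropicGaussian.exists_second_moment_le {Ω : Type*} [MeasurableSpace Ω] {P : Measure Ω}
    {T : S2 → Ω → ℝ} (hT : IsIsotropicGaussian T P) : ∃ V, ∀ y, ∫ ω, T y ω ^ 2 ∂P ≤ V := by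
  obtain ⟨x⟩ : Nonempty S2 := inferInstance
  refine ⟨max (∫ ω, T x ω ^ 2 ∂P) (∫ ω, T (-x) ω ^ 2 ∂P), fun y ↦ ?_⟩
  by_cases h : (x : E3) + y = 0
  · have : y = -x := by
      ext1
      exact eq_neg_of_add_eq_zero_right h
    rw [this]
    exact le_max_right _ _
  · obtain ⟨R, hR, rfl⟩ := exists_rotate_eq x y h
    refine le_of_eq_of_le ?_ (le_max_left _ _)
    have hmap := hT.isotropic R hR {x}
    have hm : ∀ y, AEMeasurable (T y) P := fun y ↦ (hT.memLp_two y).aemeasurable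
    have hc : Continuous fun v : ({x} : Finset S2) → ℝ ↦ v ⟨x, Finset.mem_singleton_self x⟩ ^ 2 := by
      fun_prop
    have h1 := integral_map (μ := P) (φ := fun ω (i : ({x} : Finset S2)) ↦ T (rotate R i) ω)
      (aemeasurable_pi_lambda _ fun i ↦ hm _) hc.aestronglyMeasurable
    have h2 := integral_map (μ := P) (φ := fun ω (i : ({x} : Finset S2)) ↦ T i ω)
      (aemeasurable_pi_lambda _ fun i ↦ hm _) hc.aestronglyMeasurable
    rw [hmap] at h1
    exact h1.symm.trans h2

/-- A term can be nonzero only if `l / B ^ j ≤ B`, which gives the cutoff `B * B ^ j`. The needlet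
field is thus itself a smoothing of `T`. -/
lemma exists_needletKernel_eq {B : ℝ} {b : ℝ → ℝ} (hB : 1 < B)
    (hb : Function.support b ⊆ Icc B⁻¹ B) (j : ℕ) :
    ∃ (L : ℕ) (μ : ℕ → ℝ), needletKernel B b j = smoothingKernel L μ := by
  refine ⟨⌈B * B ^ j⌉₊, fun l ↦ b (l / B ^ j), ?_⟩
  funext t
  have hpos : 0 < B ^ j := pow_pos (zero_lt_one.trans hB) j
  rw [needletKernel, smoothingKernel, tsum_eq_sum (s := Finset.range (⌈B * B ^ j⌉₊ + 1))]
  · exact Finset.sum_congr rfl fun l _ ↦ by ring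
  · intro l hl
    have h1 : b (l / B ^ j) = 0 := by
      by_contra h
      have h2 := (hb (Function.mem_support.2 h)).2
      rw [div_le_iff₀ hpos] at h2
      have h3 : (l : ℝ) ≤ (⌈B * B ^ j⌉₊ : ℝ) := h2.trans (Nat.le_ceil _)
      exact hl (Finset.mem_range.2 (Nat.lt_succ_of_le (by exact_mod_cast h3)))
    rw [h1]
    ring

section

variable {Ω : Type*} [MeasurableSpace Ω] {P : Measure Ω} [IsProbabilityMeasure P]

lemma hermite_normalizedNeedletField {T : S2 → Ω → ℝ} (hm : Measurable (Function.uncurry T))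
    (hT : IsIsotropicGaussian T P) {B : ℝ} {b : ℝ → ℝ} (hB : 1 < B)
    (hb : Function.support b ⊆ Icc B⁻¹ B) (q j : ℕ) :
    Measurable (Function.uncurry fun y ω ↦ hermiteH q (normalizedNeedletField P B b T j y ω)) ∧
      ∀ y, MemLp (fun ω ↦ hermiteH q (normalizedNeedletField P B b T j y ω)) 2 P ∧
        ∫ ω, hermiteH q (normalizedNeedletField P B b T j y ω) ^ 2 ∂P ≤ hermiteBound q := by
  obtain ⟨L, μ, hL⟩ := exists_needletKernel_eq hB hb j
  obtain ⟨V, hV⟩ := hT.exists_second_moment_le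
  have hT2 := memLp_uncurry_of_integral_sq_le hm hT.memLp_two hV
  have hβ : needletField B b T j = fun x ω ↦ smoothing L μ (fun y ↦ T y ω) x := by
    funext x ω
    rw [needletField, hL, smoothing]
  have hβm : Measurable (Function.uncurry (needletField B b T j)) := by
    rw [hβ]
    exact measurable_smoothing hm L μ
  have hβx : ∀ x, Measurable (needletField B b T j x) := fun x ↦ hβm.of_uncurry_left
  constructor
  · refine (continuous_hermiteH q).measurable.comp (hβm.div ?_)
    -- The normalising variance is treated as a function of the point, so its measurability is part
    -- of joint measurability.
    have hmean : Measurable fun x ↦ ∫ ω, needletField B b T j x ω ∂P :=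
      (hβm.stronglyMeasurable.integral_prod_right' (ν := P)).measurable
    have hvar : (fun x ↦ variance (needletField B b T j x) P) =
        fun x ↦ ∫ ω, (needletField B b T j x ω - ∫ ω, needletField B b T j x ω ∂P) ^ 2 ∂P :=
      funext fun x ↦ variance_eq_integral (hβx x).aemeasurable
    have hsq : Measurable fun p : S2 × Ω ↦
        (Function.uncurry (needletField B b T j) p - ∫ ω, needletField B b T j p.1 ω ∂P) ^ 2 :=
      (hβm.sub (hmean.comp measurable_fst)).pow_const 2
    have hvarm : Measurable fun x ↦ variance (needletField B b T j x) P := by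
      rw [hvar]
      exact (hsq.stronglyMeasurable.integral_prod_right' (ν := P)).measurable
    exact (hvarm.comp measurable_fst).sqrt
  · intro y
    obtain ⟨v, hv⟩ := exists_map_smoothing_eq_gaussianReal hT.gaussian hm hT.zero_mean hT.memLp_two
      hT2 L μ y
    have hv' : P.map (needletField B b T j y) = gaussianReal 0 v := by
      rw [hβ]
      exact hv
    exact hermiteH_normalized (hβx y) hv' q

/-! ### Recovering a smoothing representation from the covariance -/

variable {U : S2 → Ω → ℝ}

lemma lintegral_lintegral_enorm_le (hU : Measurable (Function.uncurry U))
    (hU2 : MemLp (Function.uncurry U) 2 (surface.prod P)) {A : ℝ}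
    (hA : ∫ p, Function.uncurry U p ^ 2 ∂(surface.prod P) ≤ A) :
    ∫⁻ ω, ∫⁻ y, ‖U y ω‖ₑ ∂surface ∂P ≤ ENNReal.ofReal (4 * Real.pi + A) := by
  have h1 : ∫⁻ ω, ∫⁻ y, ‖U y ω‖ₑ ∂surface ∂P =
      ∫⁻ p, ‖Function.uncurry U p‖ₑ ∂(surface.prod P) :=
    (lintegral_prod_symm' _ hU.enorm).symm
  have hi : Integrable (Function.uncurry U) (surface.prod P) := hU2.integrable (by norm_num)
  rw [h1, ← ofReal_integral_norm_eq_lintegral_enorm hi]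
  refine ENNReal.ofReal_le_ofReal ?_
  -- The inequality `|u| ≤ 1 + u²`, on a product space of mass `4π`.
  have h2 : ∫ p, ‖Function.uncurry U p‖ ∂(surface.prod P) ≤
      ∫ p, (1 + Function.uncurry U p ^ 2) ∂(surface.prod P) := by
    refine integral_mono hi.norm ((integrable_const 1).add hU2.integrable_sq) fun p ↦ ?_
    change |Function.uncurry U p| ≤ 1 + Function.uncurry U p ^ 2
    rw [← sq_abs]
    nlinarith [sq_nonneg (|Function.uncurry U p| - 1), abs_nonneg (Function.uncurry U p)]
  refine h2.trans ?_
  rw [integral_add (integrable_const 1) hU2.integrable_sq, integral_const, smul_eq_mul, mul_one,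
    ← univ_prod_univ, measureReal_prod_prod, surface_real_univ, probReal_univ, mul_one]
  linarith

/-- A second-order field whose covariance is reproduced by a smoothing kernel is itself
reproduced by that kernel. -/
lemma ae_eq_smoothing_of_covariance (hU : Measurable (Function.uncurry U))
    (hU2 : MemLp (Function.uncurry U) 2 (surface.prod P)) (h2 : ∀ x, MemLp (U x) 2 P) {L : ℕ}
    {μ : ℕ → ℝ} (hrep : ∀ x z, smoothing L μ (fun y ↦ ∫ ω, U y ω * U z ω ∂P) x =
      ∫ ω, U x ω * U z ω ∂P) (x : S2) :
    ∀ᵐ ω ∂P, U x ω = smoothing L μ (fun y ↦ U y ω) x := by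
  have hD := memLp_smoothing hU hU2 L μ x
  have e1 : ∀ z, ∫ ω, smoothing L μ (fun y ↦ U y ω) x * U z ω ∂P = ∫ ω, U x ω * U z ω ∂P := fun z ↦ by
    rw [← smoothing_integral_mul hU2 L μ x (h2 z), hrep]
  have e2 : ∫ ω, smoothing L μ (fun y ↦ U y ω) x * smoothing L μ (fun y ↦ U y ω) x ∂P =
      ∫ ω, U x ω * U x ω ∂P := by
    rw [← smoothing_integral_mul hU2 L μ x hD, ← hrep x x]
    congr 1
    funext y
    have := e1 y
    simp only [mul_comm (U x _)] at this
    rw [← this]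
    exact integral_congr_ae (Eventually.of_forall fun ω ↦ mul_comm _ _)
  -- The cross moment and the second moment of the smoothing both equal that of `U x`, so the square
  -- expands to `a - 2a + a`.
  have h0 : ∫ ω, (U x ω - smoothing L μ (fun y ↦ U y ω) x) ^ 2 ∂P = 0 := by
    have hexp : ∀ ω, (U x ω - smoothing L μ (fun y ↦ U y ω) x) ^ 2 =
        U x ω * U x ω - 2 * (smoothing L μ (fun y ↦ U y ω) x * U x ω) +
          smoothing L μ (fun y ↦ U y ω) x * smoothing L μ (fun y ↦ U y ω) x := fun ω ↦ by ring
    simp_rw [hexp]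
    have i1 : Integrable (fun ω ↦ U x ω * U x ω) P := (h2 x).integrable_mul (h2 x)
    have i2 : Integrable (fun ω ↦ 2 * (smoothing L μ (fun y ↦ U y ω) x * U x ω)) P :=
      (hD.integrable_mul (h2 x)).const_mul 2
    have i3 : Integrable (fun ω ↦ smoothing L μ (fun y ↦ U y ω) x *
      smoothing L μ (fun y ↦ U y ω) x) P := hD.integrable_mul hD
    have i12 : Integrable (fun ω ↦ U x ω * U x ω -
      2 * (smoothing L μ (fun y ↦ U y ω) x * U x ω)) P := i1.sub i2
    rw [integral_add i12 i3, integral_sub i1 i2, integral_const_mul, e1, e2]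
    ring
  have h3 := (integral_eq_zero_iff_of_nonneg (fun ω ↦ sq_nonneg _)
    ((h2 x).sub hD).integrable_sq).1 h0
  filter_upwards [h3] with ω hω
  exact sub_eq_zero.1 (pow_eq_zero_iff two_ne_zero |>.1 hω)

/-- Centring only one factor makes the covariance a mixed moment with a fixed variable, the form to
which `smoothing_integral_mul` applies. -/
lemma covariance_eq_integral_mul_sub {X Y : Ω → ℝ} (hX : MemLp X 2 P) (hY : MemLp Y 2 P) :
    covariance X Y P = ∫ ω, X ω * (Y ω - ∫ ω, Y ω ∂P) ∂P := by
  have hX1 : Integrable X P := hX.integrable (by norm_num)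
  have hXY : Integrable (fun ω ↦ X ω * Y ω) P := hX.integrable_mul hY
  rw [covariance_eq_sub hX hY]
  simp only [mul_sub]
  rw [integral_sub hXY (hX1.mul_const _), integral_mul_const]
  rfl

/-- The covariance function of a smoothed field is reproduced by the projection kernel. -/
lemma smoothing_covariance (hU : Measurable (Function.uncurry U))
    (hU2 : MemLp (Function.uncurry U) 2 (surface.prod P)) (L : ℕ) (κ : ℕ → ℝ) (x z : S2) :
    smoothing L (fun _ ↦ 1) (fun y ↦ covariance (fun ω ↦ smoothing L κ (fun y ↦ U y ω) y)
      (fun ω ↦ smoothing L κ (fun y ↦ U y ω) z) P) x =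
      covariance (fun ω ↦ smoothing L κ (fun y ↦ U y ω) x)
        (fun ω ↦ smoothing L κ (fun y ↦ U y ω) z) P := by
  have hg := memLp_smoothing hU hU2 L κ
  have hY : MemLp (fun ω ↦ smoothing L κ (fun y ↦ U y ω) z -
      ∫ ω, smoothing L κ (fun y ↦ U y ω) z ∂P) 2 P := (hg z).sub (memLp_const _)
  simp only [fun y ↦ covariance_eq_integral_mul_sub (hg y) (hg z)]
  rw [smoothing_integral_mul (memLp_uncurry_smoothing hU hU2 L κ) L _ x hY]
  refine integral_congr_ae ?_
  filter_upwards [ae_memLp_two_of_prod hU hU2] with ω hω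
  have := smoothing_smoothing (L := L) (fun _ ↦ 1) κ (hω.integrable (by norm_num)) x
  simp only [one_mul] at this
  rw [show smoothing L (fun _ ↦ 1) (fun y ↦ smoothing L κ (fun y ↦ U y ω) y) x = _ from this]

lemma integral_prod_smoothing_sq_le (hU : Measurable (Function.uncurry U))
    (hU2 : MemLp (Function.uncurry U) 2 (surface.prod P)) {L : ℕ} {κ : ℕ → ℝ} {M : ℝ}
    (hκ : ∀ l ≤ L, |κ l| ≤ M) :
    ∫ x, ∫ ω, smoothing L κ (fun y ↦ U y ω) x ^ 2 ∂P ∂surface ≤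
      M ^ 2 * ∫ p, Function.uncurry U p ^ 2 ∂(surface.prod P) := by
  have hg := memLp_uncurry_smoothing hU hU2 L κ
  rw [integral_integral_swap (f := fun x ω ↦ smoothing L κ (fun y ↦ U y ω) x ^ 2) hg.integrable_sq,
    integral_prod_symm _ hU2.integrable_sq, ← integral_const_mul]
  refine integral_mono_ae hg.integrable_sq.integral_prod_right
    (hU2.integrable_sq.integral_prod_right.const_mul _) ?_
  filter_upwards [ae_memLp_two_of_prod hU hU2] with ω hω
  exact integral_smoothing_sq_le hκ hω

end

open TopologicalSpace in
/-- A continuous Gaussian field with the covariance of a smoothed field is itself the smoothing,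
by the projection kernel, of a field with a controlled second moment. -/
lemma exists_smoothing_of_covariance_eq {Ω Ω' : Type*} [MeasurableSpace Ω] [MeasurableSpace Ω']
    {P : Measure Ω} [IsProbabilityMeasure P] {P' : Measure Ω'} [IsProbabilityMeasure P']
    {U : S2 → Ω → ℝ} (hU : Measurable (Function.uncurry U))
    (hU2 : MemLp (Function.uncurry U) 2 (surface.prod P)) {L : ℕ} {κ : ℕ → ℝ} {M : ℝ}
    (hκ : ∀ l ≤ L, |κ l| ≤ M) {f : S2 → Ω' → ℝ} (hf : IsIsotropicGaussian f P')
    (hc : ∀ᵐ ω ∂P', Continuous fun x ↦ f x ω)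
    (hcov : ∀ x y, covariance (f x) (f y) P' = covariance (fun ω ↦ smoothing L κ (fun y ↦ U y ω) x)
      (fun ω ↦ smoothing L κ (fun y ↦ U y ω) y) P) :
    ∃ F : S2 → Ω' → ℝ, Measurable (Function.uncurry F) ∧
      MemLp (Function.uncurry F) 2 (surface.prod P') ∧
      ∫ p, Function.uncurry F p ^ 2 ∂(surface.prod P') ≤
        M ^ 2 * ∫ p, Function.uncurry U p ^ 2 ∂(surface.prod P) ∧
      ∀ᵐ ω ∂P', Integrable (fun y ↦ F y ω) surface ∧
        ∀ x, f x ω = smoothing L (fun _ ↦ 1) (fun y ↦ F y ω) x := by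
  have hpath := (isRandomContinuous_of_aemeasurable hc
    fun x ↦ (hf.memLp_two x).aemeasurable).aemeasurable_path
  -- A measurable version of the path map gives a jointly measurable field.
  set G : Ω' → C(S2, ℝ) := hpath.mk _ with hG
  have hGm : Measurable G := hpath.measurable_mk
  have hGf : ∀ᵐ ω ∂P', ∀ x, f x ω = G ω x := by
    filter_upwards [hpath.ae_eq_mk, hc] with ω h1 h2 x
    rw [hG, ← h1, toPath, dif_pos h2]
    rfl
  have hGfx : ∀ x, f x =ᵐ[P'] fun ω ↦ G ω x := fun x ↦ hGf.mono fun ω h ↦ h x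
  have hFx : ∀ x, Measurable fun ω ↦ G ω x := fun x ↦
    (continuous_eval_const x).measurable.comp hGm
  have hFm : Measurable (Function.uncurry fun x ω ↦ G ω x) :=
    measurable_uncurry_of_continuous_of_measurable (u := fun x ω ↦ G ω x)
      (fun ω ↦ (G ω).continuous) hFx
  have hF2 : ∀ x, MemLp (fun ω ↦ G ω x) 2 P' := fun x ↦ (hf.memLp_two x).ae_eq (hGfx x)
  have hg := memLp_smoothing hU hU2 L κ
  have hFcov : ∀ x y, ∫ ω, G ω x * G ω y ∂P' =
      covariance (fun ω ↦ smoothing L κ (fun y ↦ U y ω) x)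
      (fun ω ↦ smoothing L κ (fun y ↦ U y ω) y) P := by
    intro x y
    rw [← hcov, covariance_eq_integral_mul_sub (hf.memLp_two x) (hf.memLp_two y), hf.zero_mean y]
    refine integral_congr_ae ?_
    filter_upwards [hGf] with ω h
    rw [h, h, sub_zero]
  -- Only an inequality: the smoothed field on the right may have nonzero mean, for instance when
  -- the Hermite degree is 0.
  have hvar : ∀ x, ∫ ω, G ω x ^ 2 ∂P' ≤ ∫ ω, smoothing L κ (fun y ↦ U y ω) x ^ 2 ∂P := by
    intro x
    simp only [sq (G _ x)]
    rw [hFcov, covariance_self (hg x).aemeasurable]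
    exact variance_le_expectation_sq (hg x).aestronglyMeasurable
  have hgsq := (memLp_uncurry_smoothing hU hU2 L κ).integrable_sq.integral_prod_left
  have hFU2 : MemLp (Function.uncurry fun x ω ↦ G ω x) 2 (surface.prod P') := by
    rw [memLp_two_iff_integrable_sq hFm.aestronglyMeasurable,
      integrable_prod_iff (hFm.pow_const 2).aestronglyMeasurable]
    refine ⟨Eventually.of_forall fun y ↦ (hF2 y).integrable_sq, ?_⟩
    refine hgsq.mono'
      (hFm.pow_const 2).norm.stronglyMeasurable.integral_prod_right'.aestronglyMeasurable
      (Eventually.of_forall fun y ↦ ?_)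
    rw [Real.norm_eq_abs, abs_of_nonneg (integral_nonneg fun ω ↦ norm_nonneg _)]
    simpa [Function.uncurry] using hvar y
  refine ⟨fun x ω ↦ G ω x, hFm, hFU2, ?_, ?_⟩
  · refine le_trans ?_ (integral_prod_smoothing_sq_le hU hU2 hκ)
    rw [integral_prod _ hFU2.integrable_sq]
    exact integral_mono hFU2.integrable_sq.integral_prod_left hgsq hvar
  · have hrep : ∀ x, ∀ᵐ ω ∂P', G ω x = smoothing L (fun _ ↦ 1) (fun y ↦ G ω y) x := by
      refine ae_eq_smoothing_of_covariance hFm hFU2 hF2 fun x z ↦ ?_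
      simp only [hFcov]
      exact smoothing_covariance hU hU2 L κ x z
    -- The representation holds almost surely at each point; a countable dense set and continuity of
    -- both sides give it at all points at once.
    have hall : ∀ᵐ ω ∂P', ∀ n, G ω (denseSeq S2 n) =
        smoothing L (fun _ ↦ 1) (fun y ↦ G ω y) (denseSeq S2 n) :=
      ae_all_iff.2 fun n ↦ hrep _
    filter_upwards [hGf, hall] with ω h1 h2
    have hi : Integrable (fun y ↦ G ω y) surface := integrable_of_continuous (G ω).continuous
    refine ⟨hi, fun x ↦ ?_⟩
    rw [h1]
    have : (fun x ↦ G ω x) = smoothing L (fun _ ↦ 1) (fun y ↦ G ω y) := by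
      refine Continuous.ext_on (denseRange_denseSeq S2) (G ω).continuous
        (continuous_smoothing hi) ?_
      rintro _ ⟨n, rfl⟩
      exact h2 n
    exact congrFun this x

end SphericalField

end

/-! ### The main theorem -/

theorem mainTheorem6 (q : ℕ) (M : ℝ) :
    ∃ C : ℝ, 0 < C ∧
      ∀ (L : ℕ) (κ : ℕ → ℝ), (∀ l ≤ L, |κ l| ≤ M) →
      ∀ (B : ℝ) (b : ℝ → ℝ), 1 < B → Function.support b ⊆ Set.Icc B⁻¹ B →
      ∀ (Ω : Type*) [MeasurableSpace Ω] (P : Measure Ω) [IsProbabilityMeasure P]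
        (T : SphericalField.S2 → Ω → ℝ),
        Measurable (Function.uncurry T) → SphericalField.IsIsotropicGaussian T P →
      ∀ (Ω' : ℕ → Type*) [∀ j, MeasurableSpace (Ω' j)] (P' : ∀ j, Measure (Ω' j))
        [∀ j, IsProbabilityMeasure (P' j)] (f : ∀ j, SphericalField.S2 → Ω' j → ℝ),
        (∀ j, SphericalField.IsIsotropicGaussian (f j) (P' j)) →
        (∀ j, ∀ᵐ ω ∂(P' j), Continuous fun x ↦ f j x ω) →
        (∀ j x y, covariance (f j x) (f j y) (P' j) =
          covariance (SphericalField.gField P L κ B b T q j x)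
            (SphericalField.gField P L κ B b T q j y) P) →
      (∀ j, SphericalField.IsRandomContinuous (SphericalField.gField P L κ B b T q j) P) ∧
      (∀ j, SphericalField.IsRandomContinuous (f j) (P' j)) ∧
      IsTightMeasureSet (Set.range fun j ↦
        SphericalField.pathLaw (SphericalField.gField P L κ B b T q j) P) ∧
      IsTightMeasureSet (Set.range fun j ↦ SphericalField.pathLaw (f j) (P' j)) ∧
      ∀ (j : ℕ) (δ : ℝ), 0 < δ →
        ∫⁻ ω, SphericalField.modulus δ
            (fun x ↦ SphericalField.gField P L κ B b T q j x ω) ∂P ≤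
          ENNReal.ofReal (C * (L : ℝ) ^ 3 * δ) ∧
        ∫⁻ ω, SphericalField.modulus δ (fun x ↦ f j x ω) ∂(P' j) ≤
          ENNReal.ofReal (C * (L : ℝ) ^ 3 * δ) := by
  open SphericalField in
  have hpi := Real.pi_pos
  have hq := hermiteBound_nonneg q
  set A : ℝ := 4 * Real.pi * hermiteBound q with hA
  have hA0 : 0 ≤ A := by positivity
  -- The first summand serves `g`, the second serves `f`. The absolute value keeps the constant
  -- positive when `M < 0`, where no `κ` is admissible.
  refine ⟨|M| * (4 * Real.pi + A) + (4 * Real.pi + M ^ 2 * A), by positivity, ?_⟩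
  intro L κ hκ B b hB hb Ω _ P _ T hTm hT Ω' _ P' _ f hf hfc hcov
  have hM : 0 ≤ M := (abs_nonneg _).trans (hκ 0 (Nat.zero_le L))
  set Z : ℕ → S2 → Ω → ℝ := fun j y ω ↦ hermiteH q (normalizedNeedletField P B b T j y ω) with hZ
  have hZm : ∀ j, Measurable (Function.uncurry (Z j)) := fun j ↦
    (hermite_normalizedNeedletField hTm hT hB hb q j).1
  have hZy := fun j ↦ (hermite_normalizedNeedletField hTm hT hB hb q j).2
  have hZ2 : ∀ j, MemLp (Function.uncurry (Z j)) 2 (surface.prod P) := fun j ↦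
    memLp_uncurry_of_integral_sq_le (hZm j) (fun y ↦ (hZy j y).1) (fun y ↦ (hZy j y).2)
  have hZA : ∀ j, ∫ p, Function.uncurry (Z j) p ^ 2 ∂(surface.prod P) ≤ A := by
    intro j
    rw [integral_prod _ (hZ2 j).integrable_sq]
    refine (integral_mono (hZ2 j).integrable_sq.integral_prod_left
      (integrable_const (hermiteBound q)) fun y ↦ (hZy j y).2).trans (le_of_eq ?_)
    rw [integral_const, surface_real_univ, smul_eq_mul]
  have hgs : ∀ j, ∀ᵐ ω ∂P, Integrable (fun y ↦ Z j y ω) surface ∧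
      ∀ x, gField P L κ B b T q j x ω = smoothing L κ (fun y ↦ Z j y ω) x := by
    intro j
    filter_upwards [ae_memLp_two_of_prod (hZm j) (hZ2 j)] with ω hω
    exact ⟨hω.integrable (by norm_num), fun x ↦ rfl⟩
  have hgR : ∀ j, IsRandomContinuous (gField P L κ B b T q j) P := fun j ↦
    isRandomContinuous_of_aemeasurable (ae_continuous_of_smoothing (hgs j))
      fun x ↦ (memLp_smoothing (hZm j) (hZ2 j) L κ x).aemeasurable
  have hgA : ∀ j, ∫⁻ ω, ∫⁻ y, ‖Z j y ω‖ₑ ∂surface ∂P ≤ ENNReal.ofReal (4 * Real.pi + A) := fun j ↦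
    lintegral_lintegral_enorm_le (hZm j) (hZ2 j) (hZA j)
  have hfR : ∀ j, IsRandomContinuous (f j) (P' j) := fun j ↦
    isRandomContinuous_of_aemeasurable (hfc j) fun x ↦ ((hf j).memLp_two x).aemeasurable
  choose F hFm hF2 hFA hfs using fun j ↦
    exists_smoothing_of_covariance_eq (hZm j) (hZ2 j) hκ (hf j) (hfc j) (hcov j)
  have hFA' : ∀ j, ∫⁻ ω, ∫⁻ y, ‖F j y ω‖ₑ ∂surface ∂(P' j) ≤
      ENNReal.ofReal (4 * Real.pi + M ^ 2 * A) := fun j ↦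
    lintegral_lintegral_enorm_le (hFm j) (hF2 j)
      ((hFA j).trans (mul_le_mul_of_nonneg_left (hZA j) (sq_nonneg M)))
  -- The field `f` is smoothed by the projection kernel, so its coefficient bound is 1 and `M`
  -- enters only through the second moment.
  have h1 : ∀ l ≤ L, |(fun _ : ℕ ↦ (1 : ℝ)) l| ≤ 1 := fun l _ ↦ by simp
  refine ⟨hgR, hfR, ?_, ?_, fun j δ hδ ↦ ⟨?_, ?_⟩⟩
  · exact isTightMeasureSet_smoothing hgR hgs
      (fun j ↦ (hZm j).enorm.lintegral_prod_left'.aemeasurable) hgA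
  · exact isTightMeasureSet_smoothing hfR hfs
      (fun j ↦ (hFm j).enorm.lintegral_prod_left'.aemeasurable) hFA'
  · refine (lintegral_modulus_smoothing_le hκ (hgs j) (hgA j) hδ).trans
      (ENNReal.ofReal_le_ofReal ?_)
    gcongr
    rw [abs_of_nonneg hM]
    exact le_add_of_nonneg_right (by positivity)
  · refine (lintegral_modulus_smoothing_le h1 (hfs j) (hFA' j) hδ).trans
      (ENNReal.ofReal_le_ofReal ?_)
    gcongr
    rw [one_mul]
    exact le_add_of_nonneg_left (by positivity)
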